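/- Let $n\ge 2$, $0\le k\le n$, let $K$ be the Killing form of $\mathfrak{g}=\mathfrak{sl}(n,\mathbb{C})$ (extended linearly to $\mathfrak{g}((u^{-1}))$), and let $\Omega=\sum_i I_i\otimes I_i$ for a $K$-orthonormal basis $(I_i)$ of $\mathfrak{g}$. A quasi-rational $r$-matrix is a solution $q(u,v)=\frac{uv\,\Omega}{v-u}+p(u,v)$ of the classical Yang–Baxter equation $$[q^{12}(u_1,u_2),q^{13}(u_1,u_3)]+[q^{12}(u_1,u_2),q^{23}(u_2,u_3)]+[q^{13}(u_1,u_3),q^{23}(u_2,u_3)]=0,$$ where $p\in(\mathfrak{g}\otimes\mathfrak{g})[u,v]$ is skew-symmetric, $p^{21}(v,u)=-p(u,v)$. Let $D=\mathfrak{g}((u^{-1}))\oplus\mathfrak{g}[\varepsilon]$, $\varepsilon^2=0$, with the form $$Q(f+A_0+A_1\varepsilon,\;g+B_0+B_1\varepsilon)=\mathrm{Res}_{u=0}\,u^{-2}K(f,g)-K(A_0,B_1)-K(A_1,B_0),$$ where $\mathrm{Res}_{u=0}$ is the coefficient of $u^{-1}$, and let $i:\mathfrak{g}[u]\to D$, $i(\sum_m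 c_mu^m)=\sum_m c_mu^m+c_0+c_1\varepsilon$. To a quasi-rational $r$-matrix $q$ with polynomial part $p=\sum_j a_j(u)\otimes b_j(v)$ corresponds the Lagrangian subalgebra $$W_q=\Big\{w+\sum_j Q(w,i(a_j))\,i(b_j)\;:\;w\in \mathfrak{g}[[u^{-1}]]\oplus\mathfrak{g}\varepsilon\Big\}\subset D .$$ Let $d_k=\mathrm{diag}(1,\dots,1,u,\dots,u)$ with $k$ entries $1$ and $n-k$ entries $u$, let $A_k=d_k^{-1}\mathfrak{sl}(n,\mathbb{C}[[u^{-1}]])d_k$ and $W_k=A_k\oplus\mathfrak{sl}(n,\mathbb{C}[\varepsilon])$; call $q$ related to $W_k$ if $W_q\subset W_k$. Let $P_k\subset\mathfrak{g}$ be the parabolic subalgebra of block upper triangular matrices with diagonal blocks of sizes $k$ and $n-k$ (so $P_0=P_n=\mathfrak{g}$). Theorem 5. Quasi-rational $r$-matrices related to $W_k$ are in one-to-one correspondence with the pairs $(L,B)$, where $L\subset\mathfrak{sl}(n)$ is a Lie subalgebra such that $L+P_k=\mathfrak{sl}(n)$, and $B$ is a 2-cocycle on $L$ with values in the trivial module $\mathbb{C}$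 whose restriction to $L\cap P_k$ is nondegenerate. The correspondence $q\mapsto(L,B)$ is determined by $$W_q=A_k\oplus\{x+a\varepsilon : x\in L,\ a\in\mathfrak{sl}(n),\ K(a,y)=B(x,y)\text{ for all }y\in L\}.$$ -/

import Mathlib

open scoped TensorProduct

noncomputable section

namespace QuasiRational

/-! ### Traceless matrices and the Killing form -/

/-- The Lie algebra `sl(n, R)` of traceless `n × n` matrices over `R`. -/
abbrev Sl (n : ℕ) (R : Type) [CommRing R] : Type :=
  ↥(LieAlgebra.SpecialLinear.sl (Fin n) R)

/-- Entrywise application of a `ℂ`-linear map to a traceless matrix. -/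
def slMap (n : ℕ) {R S : Type} [CommRing R] [CommRing S] [Algebra ℂ R] [Algebra ℂ S]
    (f : R →ₗ[ℂ] S) : Sl n R →ₗ[ℂ] Sl n S where
  toFun x := ⟨x.1.map f, by
    have hx : Matrix.trace x.1 = 0 := LinearMap.mem_ker.1 x.2
    have h : Matrix.trace (x.1.map f) = f (Matrix.trace x.1) := by
      simp [Matrix.trace, map_sum]
    exact LinearMap.mem_ker.2 (by
      change Matrix.trace (x.1.map f) = 0
      rw [h, hx, map_zero])⟩
  map_add' x y := by
    apply Subtype.ext
    ext i j
    exact map_add f (x.1 i j) (y.1 i j)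
  map_smul' c x := by
    apply Subtype.ext
    ext i j
    exact map_smul f c (x.1 i j)

/-- The Killing form of `sl(n, R)`, as a Lie algebra over `R`. -/
abbrev K {n : ℕ} {R : Type} [CommRing R] (x y : Sl n R) : R :=
  killingForm R (Sl n R) x y

lemma K_add_left {n : ℕ} {R : Type} [CommRing R] (x x' y : Sl n R) :
    K (x + x') y = K x y + K x' y := by
  rw [K, map_add]
  rfl

lemma K_smul_left {n : ℕ} {R : Type} [CommRing R] [Algebra ℂ R] [IsScalarTower ℂ R R]
    (c : ℂ) (x y : Sl n R) : K (c • x) y = c • K x y := by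
  have h : c • x = (c • (1 : R)) • x := by
    apply Subtype.ext
    ext i j
    change c • x.1 i j = (c • (1 : R)) * x.1 i j
    rw [smul_one_mul]
  rw [h]
  simp only [K, map_smul, LinearMap.smul_apply, smul_eq_mul]
  rw [smul_one_mul]

lemma K_smul_right {n : ℕ} {R : Type} [CommRing R] [Algebra ℂ R] [IsScalarTower ℂ R R]
    (c : ℂ) (x y : Sl n R) : K x (c • y) = c • K x y := by
  rw [K, K, LieModule.traceForm_comm, ← K, K_smul_left, K, LieModule.traceForm_comm]

/-- The Casimir element `Ω ∈ sl(n) ⊗ sl(n)`: if `(b i)` is a basis and `G` is its Gram matrix with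
respect to the Killing form, then `Ω = ∑ i j, (G⁻¹) i j • (b i ⊗ b j)`.  For a basis that is
orthonormal with respect to the Killing form this reads `∑ i, b i ⊗ b i`. -/
def casimir (n : ℕ) : Sl n ℂ ⊗[ℂ] Sl n ℂ :=
  let b := Module.finBasis ℂ (Sl n ℂ)
  let G : Matrix _ _ ℂ := Matrix.of fun i j => K (b i) (b j)
  ∑ i, ∑ j, G⁻¹ i j • (b i ⊗ₜ[ℂ] b j)

/-! ### The classical Yang-Baxter equation and quasi-rational r-matrices -/

section CYBE

variable {g : Type} [LieRing g] [LieAlgebra ℂ g]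

/-- The bracket of a Lie algebra as a bilinear map. -/
def br : g →ₗ[ℂ] g →ₗ[ℂ] g := (LieAlgebra.ad ℂ g : g →ₗ[ℂ] Module.End ℂ g)

/-- `[r¹², s¹³]`, that is `(a ⊗ b, c ⊗ d) ↦ [a, c] ⊗ (b ⊗ d)`. -/
def br₁₂₁₃ (r s : g ⊗[ℂ] g) : g ⊗[ℂ] (g ⊗[ℂ] g) :=
  TensorProduct.map₂ br (TensorProduct.mk ℂ g g) r s

/-- `[r¹², s²³]`, that is `(a ⊗ b, c ⊗ d) ↦ a ⊗ ([b, c] ⊗ d)`. -/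
def br₁₂₂₃ (r s : g ⊗[ℂ] g) : g ⊗[ℂ] (g ⊗[ℂ] g) :=
  TensorProduct.map LinearMap.id
    ((TensorProduct.map (TensorProduct.lift br) LinearMap.id) ∘ₗ
      (TensorProduct.assoc ℂ g g g).symm.toLinearMap)
    (TensorProduct.assoc ℂ g g (g ⊗[ℂ] g) (r ⊗ₜ[ℂ] s))

/-- `[r¹³, s²³]`, that is `(a ⊗ b, c ⊗ d) ↦ a ⊗ (c ⊗ [b, d])`. -/
def br₁₃₂₃ (r s : g ⊗[ℂ] g) : g ⊗[ℂ] (g ⊗[ℂ] g) :=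
  TensorProduct.assoc ℂ g g g (TensorProduct.map₂ (TensorProduct.mk ℂ g g) br r s)

/-- The classical Yang-Baxter equation with two spectral parameters, away from the diagonals. -/
def CYBE (q : ℂ → ℂ → g ⊗[ℂ] g) : Prop :=
  ∀ u₁ u₂ u₃ : ℂ, u₁ ≠ u₂ → u₁ ≠ u₃ → u₂ ≠ u₃ →
    br₁₂₁₃ (q u₁ u₂) (q u₁ u₃) + br₁₂₂₃ (q u₁ u₂) (q u₂ u₃) + br₁₃₂₃ (q u₁ u₃) (q u₂ u₃) = 0

end CYBE

/-- The polynomial Lie algebra `P = sl(n)[u] = sl(n, ℂ[u])`. -/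
abbrev PolySl (n : ℕ) : Type := Sl n (Polynomial ℂ)

/-- The value of a polynomial `c ∈ sl(n)[u]` at `u = z`. -/
def evalAt (n : ℕ) (z : ℂ) : PolySl n →ₗ[ℂ] Sl n ℂ :=
  slMap n (Polynomial.aeval z : Polynomial ℂ →ₐ[ℂ] ℂ).toLinearMap

/-- The function `q(u, v) = u v / (v - u) • Ω + p(u, v)` attached to
`p ∈ sl(n)[u] ⊗ sl(n)[v] = (sl(n) ⊗ sl(n))[u, v]`. It is only meaningful for `u ≠ v`. -/
def rFun {n : ℕ} (p : PolySl n ⊗[ℂ] PolySl n) (u v : ℂ) : Sl n ℂ ⊗[ℂ] Sl n ℂ :=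
  (u * v / (v - u)) • casimir n + TensorProduct.map (evalAt n u) (evalAt n v) p

/-- A quasi-rational r-matrix for `sl(n)`: a solution `q(u, v) = u v Ω / (v - u) + p(u, v)` of the
classical Yang-Baxter equation with a polynomial `p` that is skew-symmetric,
`p²¹(v, u) = - p(u, v)`. It is recorded by its polynomial part `p`, which `q` determines. -/
@[ext]
structure RMatrix (n : ℕ) where
  /-- the polynomial part -/
  p : PolySl n ⊗[ℂ] PolySl n
  skew : TensorProduct.comm ℂ (PolySl n) (PolySl n) p = -p
  cybe : CYBE (rFun p)

/-! ### The double -/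

/-- The field `ℂ((u⁻¹))`. The variable of the Laurent series is `u⁻¹`, so the coefficient of `u ^ m`
in `f` is `f.coeff (-m)`. -/
abbrev Laurent : Type := LaurentSeries ℂ

/-- The coefficientwise `ℂ`-algebra structure is the one used throughout. -/
instance (priority := 2000) instAlgebraLaurent : Algebra ℂ Laurent := HahnSeries.instAlgebra

instance : IsScalarTower ℂ Laurent Laurent :=
  @IsScalarTower.right ℂ Laurent _ _ instAlgebraLaurent

/-- The monomial `u ^ m ∈ ℂ((u⁻¹))`. -/
def uPow (m : ℤ) : Laurent := HahnSeries.single (-m) 1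

/-- `Res_{u = 0}`: the coefficient of `u ^ (-1)`. -/
def res (f : Laurent) : ℂ := f.coeff 1

/-- The double `sl(n)((u⁻¹)) ⊕ sl(n, ℂ[ε])`, `ε² = 0`. -/
abbrev Double (n : ℕ) : Type := Sl n Laurent × Sl n (DualNumber ℂ)

/-- `A₀` in `A = A₀ + A₁ ε`. -/
def part₀ (n : ℕ) : Sl n (DualNumber ℂ) →ₗ[ℂ] Sl n ℂ :=
  slMap n (TrivSqZeroExt.fstHom ℂ ℂ ℂ).toLinearMap

/-- `A₁` in `A = A₀ + A₁ ε`. -/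
def part₁ (n : ℕ) : Sl n (DualNumber ℂ) →ₗ[ℂ] Sl n ℂ :=
  slMap n (TrivSqZeroExt.sndHom ℂ ℂ)

/-- The invariant form of the double:
`Q (f + A₀ + A₁ ε, g + B₀ + B₁ ε) = Res_{u = 0} u⁻² K(f, g) - K(A₀, B₁) - K(A₁, B₀)`. -/
def Q (n : ℕ) : Double n →ₗ[ℂ] Double n →ₗ[ℂ] ℂ :=
  LinearMap.mk₂ ℂ
    (fun x y => res (uPow (-2) * K x.1 y.1)
      - K (part₀ n x.2) (part₁ n y.2) - K (part₁ n x.2) (part₀ n y.2))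
    (fun x x' y => by
      simp only [Prod.fst_add, Prod.snd_add, map_add, K_add_left, mul_add, res,
        HahnSeries.coeff_add]
      ring)
    (fun c x y => by
      simp only [Prod.smul_fst, Prod.smul_snd, map_smul, K_smul_left, mul_smul_comm, res,
        HahnSeries.coeff_smul, smul_eq_mul]
      ring)
    (fun x y y' => by
      simp only [Prod.fst_add, Prod.snd_add, map_add, mul_add, res, HahnSeries.coeff_add]
      ring)
    (fun c x y => by
      simp only [Prod.smul_fst, Prod.smul_snd, map_smul, K_smul_right, mul_smul_comm, res,
        HahnSeries.coeff_smul, smul_eq_mul]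
      ring)

/-- The embedding `i : P → D`, `i(∑ c_m u^m) = ∑ c_m u^m + c₀ + c₁ ε`; note that substituting `ε`
for `u` in a polynomial `∑ c_m u^m` gives `c₀ + c₁ ε`. -/
def emb (n : ℕ) : PolySl n →ₗ[ℂ] Double n :=
  (slMap n (Polynomial.aeval (uPow 1) : Polynomial ℂ →ₐ[ℂ] Laurent).toLinearMap).prod
    (slMap n (Polynomial.aeval DualNumber.eps : Polynomial ℂ →ₐ[ℂ] DualNumber ℂ).toLinearMap)

/-- The inclusion `ℂ[[u⁻¹]] → ℂ((u⁻¹))`. -/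
def ofPS : PowerSeries ℂ →ₐ[ℂ] Laurent := HahnSeries.ofPowerSeriesAlg ℤ ℂ

/-- `P* = sl(n)[[u⁻¹]] ⊕ sl(n) ε`, a Lagrangian complement of `i(P)`. -/
def dualP (n : ℕ) : Submodule ℂ (Double n) :=
  (LinearMap.range (slMap n ofPS.toLinearMap)).prod (LinearMap.ker (part₀ n))

/-- The map `(Q(w, i ·) ⊗ id) : P ⊗ P → P`, applied to `p`, as a function of `w`:
for `p = ∑ a ⊗ b` it is `w ↦ ∑ Q(w, i(a)) b`. -/
def contract {n : ℕ} (p : PolySl n ⊗[ℂ] PolySl n) : Double n →ₗ[ℂ] PolySl n where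
  toFun w := TensorProduct.lid ℂ (PolySl n) (LinearMap.rTensor (PolySl n) (Q n w ∘ₗ emb n) p)
  map_add' x y := by
    rw [map_add, LinearMap.add_comp, LinearMap.rTensor_add, LinearMap.add_apply, map_add]
  map_smul' c x := by
    rw [map_smul, LinearMap.smul_comp, LinearMap.rTensor_smul, LinearMap.smul_apply, map_smul,
      RingHom.id_apply]

/-- The Lagrangian subalgebra `W` of the double that corresponds to the quasi-rational r-matrix `q`
with polynomial part `p`. Let `(e_i)` be a basis of `P` and `(e^i)` the `Q`-dual basis of `P*`, so
that `∑ e_i ⊗ e^i` projects to `u v Ω / (v - u)`. Then `W` is the complement of `i(P)` for which the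
`Q`-dual basis `(f^i)` of `(e_i)` in `W` satisfies `∑ e_i ⊗ f^i = ∑ e_i ⊗ e^i + p`; that is,
`f^i = e^i + (Q(e^i, ·) ⊗ id) p`. -/
def RMatrix.W {n : ℕ} (q : RMatrix n) : Submodule ℂ (Double n) :=
  (dualP n).map (LinearMap.id + emb n ∘ₗ contract q.p)

/-! ### The order `W_k`, the parabolic subalgebra `P_k` and the pairs `(L, B)` -/

/-- `d_k = diag(1, …, 1, u, …, u)` with `k` entries `1` and `n - k` entries `u`. -/
def dMat (n k : ℕ) : Matrix (Fin n) (Fin n) Laurent :=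
  Matrix.diagonal fun i => if i.val < k then 1 else uPow 1

/-- `d_k⁻¹ sl(n, ℂ[[u⁻¹]]) d_k`, as a subset of `sl(n)((u⁻¹))`. -/
def order (n k : ℕ) : Set (Sl n Laurent) :=
  {f | ∃ s : Sl n (PowerSeries ℂ), f.1 = (dMat n k)⁻¹ * s.1.map ofPS * dMat n k}

/-- `W_k = d_k⁻¹ sl(n, ℂ[[u⁻¹]]) d_k ⊕ sl(n, ℂ[ε])`. -/
def orderW (n k : ℕ) : Set (Double n) := {x | x.1 ∈ order n k}

/-- `P_k`: the parabolic subalgebra of `sl(n)` that contains the upper triangular matrices and is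
attached to the `k`-th simple root, that is, the block upper triangular matrices with diagonal blocks
of sizes `k` and `n - k` (all of `sl(n)` if `k = 0` or `k = n`). -/
def parabolic (n k : ℕ) : Submodule ℂ (Sl n ℂ) where
  carrier := {x | ∀ i j : Fin n, k ≤ i.val → j.val < k → x.1 i j = 0}
  add_mem' {x y} hx hy i j hi hj := by
    change x.1 i j + y.1 i j = 0
    rw [hx i j hi hj, hy i j hi hj, add_zero]
  zero_mem' _ _ _ _ := rfl
  smul_mem' c x hx i j hi hj := by
    change c • x.1 i j = 0
    rw [hx i j hi hj, smul_zero]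

/-- The pairs `(L, B)`: a Lie subalgebra `L ⊆ sl(n)` with `L + P_k = sl(n)`, and a 2-cocycle `B` on
`L` with values in the trivial module `ℂ` whose restriction to `L ∩ P_k` is nondegenerate. -/
structure Pair (n k : ℕ) where
  /-- the subalgebra -/
  L : LieSubalgebra ℂ (Sl n ℂ)
  /-- the 2-cocycle -/
  B : LieModule.Cohomology.twoCocycle ℂ L (TrivialLieModule ℂ L ℂ)
  add_eq : L.toSubmodule ⊔ parabolic n k = ⊤
  nondeg : ∀ x : L, x.1 ∈ parabolic n k →
    (∀ y : L, y.1 ∈ parabolic n k → B.1 x y = 0) → x = 0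

/-- The value `B(x, y) ∈ ℂ`. -/
def Pair.form {n k : ℕ} (c : Pair n k) (x y : c.L) : ℂ :=
  TrivialLieModule.equiv ℂ c.L ℂ (c.B.1 x y)

/-- The Lagrangian subalgebra of `sl(n, ℂ[ε])` attached to `(L, B)`:
`{x + a ε | x ∈ L, K(a, y) = B(x, y) for all y ∈ L}`. -/
def Pair.lagr {n k : ℕ} (c : Pair n k) : Set (Sl n (DualNumber ℂ)) :=
  {A | ∃ h : part₀ n A ∈ c.L, ∀ y : c.L, K (part₁ n A) y.1 = c.form ⟨part₀ n A, h⟩ y}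

end QuasiRational

end

noncomputable section

namespace QuasiRational

/-! ### The Killing form of `sl(n)` is a multiple of the trace form -/

section Killing

variable {n : ℕ} {R : Type} [CommRing R]

/-! The double splits as `i(P) ⊕ P*` into isotropic subspaces. A tensor `p` in `P ⊗ P` acts as a map
`P* → P`, and `W_q` is its graph. If `p` is skew, the graph is isotropic and complementary to
`i(P)`, hence maximal isotropic; it determines `p`. The vectors `evalVec z a` of `P*` represent `c ↦
K(a, c(z))`. At three distinct points the Yang–Baxter expression, contracted with `a₁, a₂, a₃`, is
`Q([V₁, V₂], V₃)` for the lifts `Vᵢ` of these vectors to the graph (`tri_cybe`). Evaluations outside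
a finite set separate polynomials, so the equation holds exactly when the graph is a subalgebra
(`lie_mem_graph`, `cybe_of_lie_mem`).

The order `A_k` is isotropic. If `W_q ⊂ W_k`, then `A_k` is orthogonal to `W_q`, so it lies in
`W_q`, and `W_q = A_k ⊕ V` with `V` a Lagrangian subalgebra of `sl(n, ℂ[ε])`. The polynomials that
`i` sends into `W_k` are `x + b u` with `x ∈ P_k`, `b ∈ P_k^⊥`, so transversality to `i(P)` becomes
`V ∩ (P_k ⊕ P_k^⊥ ε) = 0`. Put `L` for the projection of `V` and `B(x, y) = K(a, y)` for `x + a ε ∈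
V`: isotropy makes `B` well defined and alternating, and closure under the bracket is the cocycle
identity. The intersection contains some `a ε ≠ 0` exactly when `L + P_k ≠ sl(n)`; when the sum is
everything, the remaining condition is nondegeneracy of `B` on `L ∩ P_k` (`exists_lagr_eq`,
`Pair.eq_zero_of_mem_lagr`).

Conversely `A_k ⊕ V` contains `u⁻¹ sl(n)[[u⁻¹]]`. The projection of `P*` to `i(P)` along it
therefore factors through a finite-dimensional quotient, and so is given by a tensor
(`exists_graph_eq`). -/

lemma trace_sl (x : Sl n R) : Matrix.trace x.1 = 0 := LinearMap.mem_ker.1 x.2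

lemma sl_lie_val (x y : Sl n R) : (⁅x, y⁆ : Sl n R).1 = x.1 * y.1 - y.1 * x.1 := rfl

/-- The endomorphism `ad x ∘ ad y` of `gl(n)`. -/
def adAd (x y : Matrix (Fin n) (Fin n) R) :
    Matrix (Fin n) (Fin n) R →ₗ[R] Matrix (Fin n) (Fin n) R :=
  (LinearMap.mulLeft R x - LinearMap.mulRight R x) ∘ₗ
    (LinearMap.mulLeft R y - LinearMap.mulRight R y)

lemma adAd_apply (x y z : Matrix (Fin n) (Fin n) R) :
    adAd x y z = x * (y * z - z * y) - (y * z - z * y) * x := by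
  simp [adAd]

/-- The map `z ↦ a z b` has trace `tr a · tr b`, and `ad x ∘ ad y` is a signed sum of four such
maps; the proof reads off the diagonal coefficients on matrix units. -/
lemma trace_adAd (x y : Matrix (Fin n) (Fin n) R) :
    LinearMap.trace R _ (adAd x y)
      = 2 * n * Matrix.trace (x * y) - 2 * Matrix.trace x * Matrix.trace y := by
  have key : ∀ i j : Fin n, adAd x y (Matrix.single i j 1) i j
      = (x * y) i i - x i i * y j j - y i i * x j j + (y * x) j j := by
    intro i j
    rw [adAd_apply, mul_sub, sub_mul]
    simp only [Matrix.sub_apply]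
    have e1 : (x * (y * Matrix.single i j (1 : R))) i j = (x * y) i i := by
      rw [← mul_assoc]; simp
    have e2 : (Matrix.single i j (1 : R) * y * x) i j = (y * x) j j := by
      rw [mul_assoc]; simp
    have e3 : (x * (Matrix.single i j (1 : R) * y)) i j = x i i * y j j := by
      rw [← mul_assoc, Matrix.mul_apply, Finset.sum_eq_single j]
      · simp
      · intro l _ hl; simp [Matrix.mul_single_apply_of_ne _ _ _ _ _ hl]
      · simp
    have e4 : (y * Matrix.single i j (1 : R) * x) i j = y i i * x j j := by
      rw [Matrix.mul_apply, Finset.sum_eq_single j]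
      · simp
      · intro l _ hl; simp [Matrix.mul_single_apply_of_ne _ _ _ _ _ hl]
      · simp
    rw [e1, e2, e3, e4]; ring
  rw [LinearMap.trace_eq_matrix_trace R (Matrix.stdBasis R (Fin n) (Fin n)), Matrix.trace]
  simp only [Matrix.diag_apply, LinearMap.toMatrix_apply]
  rw [Fintype.sum_prod_type]
  have : ∀ i j : Fin n, ((Matrix.stdBasis R (Fin n) (Fin n)).repr
      (adAd x y ((Matrix.stdBasis R (Fin n) (Fin n)) (i, j)))) (i, j)
      = (x * y) i i - x i i * y j j - y i i * x j j + (y * x) j j := by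
    intro i j
    rw [Matrix.stdBasis_eq_single, ← key]
    rfl
  simp only [this, Finset.sum_add_distrib, Finset.sum_sub_distrib, Finset.sum_const,
    Finset.card_univ, Fintype.card_fin, ← Finset.mul_sum, ← Finset.sum_mul, nsmul_eq_mul]
  have h1 : ∑ i, (y * x) i i = Matrix.trace (x * y) := Matrix.trace_mul_comm y x
  rw [h1]
  simp only [Matrix.trace, Matrix.diag_apply]
  ring

/-- Commutators are traceless, so `ad x ∘ ad y` maps all of `gl(n)` into `sl(n)`, and its trace on
`gl(n)` equals its trace on `sl(n)`. It is used over `ℂ` and over `ℂ((u⁻¹))`. -/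
lemma K_eq_trace {R : Type} [Field R] (x y : Sl n R) :
    K x y = 2 * n * Matrix.trace (x.1 * y.1) := by
  have hmem : ∀ z, adAd x.1 y.1 z ∈ (LinearMap.ker (Matrix.traceLinearMap (Fin n) R R)) := by
    intro z
    rw [adAd_apply]
    refine LinearMap.mem_ker.2 ?_
    rw [Matrix.traceLinearMap_apply, Matrix.trace_sub, Matrix.trace_mul_comm, sub_self]
  have h := LinearMap.trace_restrict_eq_of_forall_mem
    (LinearMap.ker (Matrix.traceLinearMap (Fin n) R R)) (adAd x.1 y.1) hmem
  rw [trace_adAd, trace_sl x, mul_zero, zero_mul, sub_zero] at h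
  rw [← h]
  rfl

lemma K_comm (x y : Sl n R) : K x y = K y x := LieModule.traceForm_comm R (Sl n R) (Sl n R) x y

lemma K_lie_left (x y z : Sl n R) : K ⁅x, y⁆ z = K x ⁅y, z⁆ :=
  LieModule.traceForm_apply_lie_apply R (Sl n R) (Sl n R) x y z

lemma K_add_right (x y y' : Sl n R) : K x (y + y') = K x y + K x y' := map_add _ _ _
lemma K_sub_right (x y y' : Sl n R) : K x (y - y') = K x y - K x y' := map_sub _ _ _
lemma K_neg_right (x y : Sl n R) : K x (-y) = -K x y := map_neg _ _
lemma K_zero_right (x : Sl n R) : K x 0 = 0 := map_zero _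
lemma K_sub_left (x x' y : Sl n R) : K (x - x') y = K x y - K x' y := by
  rw [K_comm, K_sub_right, K_comm x, K_comm x']
lemma K_neg_left (x y : Sl n R) : K (-x) y = -K x y := by
  rw [K_comm, K_neg_right, K_comm x]
lemma K_zero_left (x : Sl n R) : K 0 x = 0 := by rw [K_comm, K_zero_right]

/-- The conjugate transpose, cut down to the blocks of `P_k`. -/
def conjCut (k : ℕ) (a : Sl n ℂ) : Sl n ℂ :=
  ⟨Matrix.of fun i j => if k ≤ i.val ∧ j.val < k then 0 else star (a.1 j i), by
    refine LinearMap.mem_ker.2 ?_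
    change ∑ i : Fin n, (if k ≤ i.val ∧ i.val < k then 0 else star (a.1 i i)) = 0
    have h : ∀ i : Fin n, (if k ≤ i.val ∧ i.val < k then (0 : ℂ) else star (a.1 i i))
        = star (a.1 i i) := fun i => if_neg (by omega)
    simp only [h]
    rw [← star_sum]
    have : ∑ i : Fin n, a.1 i i = 0 := trace_sl a
    rw [this, star_zero]⟩

lemma conjCut_mem (k : ℕ) (a : Sl n ℂ) : conjCut k a ∈ parabolic n k :=
  fun _ _ hi hj => if_pos ⟨hi, hj⟩

/-- The value `K a (conjCut k a)` is `2n` times the sum of `|a i j|²` over the entries outside the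
upper right block. For `k = 0` that block is empty. -/
lemma eq_zero_of_K_conjCut (hn : n ≠ 0) (k : ℕ) (a : Sl n ℂ) (h : K a (conjCut k a) = 0)
    (i j : Fin n) (hij : ¬ (i.val < k ∧ k ≤ j.val)) : a.1 i j = 0 := by
  have hn' : (n : ℂ) ≠ 0 := Nat.cast_ne_zero.2 hn
  rw [K_eq_trace] at h
  have h2 : Matrix.trace (a.1 * (conjCut k a).1) = 0 := by
    rcases mul_eq_zero.1 h with h | h
    · exact absurd h (mul_ne_zero two_ne_zero hn')
    · exact h
  have h3 : ∑ i, ∑ j, (if k ≤ j.val ∧ i.val < k then (0 : ℝ) else Complex.normSq (a.1 i j)) = 0 := by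
    have h4 : ((∑ i, ∑ j, (if k ≤ j.val ∧ i.val < k then (0 : ℝ) else
        Complex.normSq (a.1 i j)) : ℝ) : ℂ) = 0 := by
      rw [← h2, Matrix.trace]
      push_cast
      refine Finset.sum_congr rfl fun i _ => ?_
      rw [Matrix.diag_apply, Matrix.mul_apply]
      refine Finset.sum_congr rfl fun j _ => ?_
      change _ = a.1 i j * (if k ≤ j.val ∧ i.val < k then 0 else star (a.1 i j))
      split_ifs
      · simp
      · exact (Complex.mul_conj _).symm
    exact_mod_cast h4
  have hnn : ∀ i j : Fin n, 0 ≤ (if k ≤ j.val ∧ i.val < k then (0 : ℝ) else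
      Complex.normSq (a.1 i j)) := fun i j => by
    split_ifs
    · exact le_rfl
    · exact Complex.normSq_nonneg _
  have h5 := (Finset.sum_eq_zero_iff_of_nonneg
    (fun i _ => Finset.sum_nonneg fun j _ => hnn i j)).1 h3 i (Finset.mem_univ _)
  have h6 := (Finset.sum_eq_zero_iff_of_nonneg (fun j _ => hnn i j)).1 h5 j (Finset.mem_univ _)
  rw [if_neg (by tauto)] at h6
  exact Complex.normSq_eq_zero.1 h6

lemma K_nondegenerate (hn : n ≠ 0) (a : Sl n ℂ) (h : ∀ b, K a b = 0) : a = 0 := by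
  apply Subtype.ext
  ext i j
  exact eq_zero_of_K_conjCut hn 0 a (h _) i j (by omega)

/-- The orthogonal complement of `P_k` consists of the strictly upper block triangular matrices. -/
lemma eq_zero_of_K_parabolic (hn : n ≠ 0) {k : ℕ} {a : Sl n ℂ}
    (h : ∀ b ∈ parabolic n k, K a b = 0) (i j : Fin n) (hij : ¬ (i.val < k ∧ k ≤ j.val)) :
    a.1 i j = 0 :=
  eq_zero_of_K_conjCut hn k a (h _ (conjCut_mem k a)) i j hij

lemma K_eq_zero_of_parabolic {k : ℕ} {a b : Sl n ℂ}
    (ha : ∀ i j : Fin n, ¬ (i.val < k ∧ k ≤ j.val) → a.1 i j = 0) (hb : b ∈ parabolic n k) :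
    K a b = 0 := by
  rw [K_eq_trace, Matrix.trace]
  refine mul_eq_zero_of_right _ (Finset.sum_eq_zero fun i _ => ?_)
  rw [Matrix.diag_apply, Matrix.mul_apply]
  refine Finset.sum_eq_zero fun j _ => ?_
  by_cases h : i.val < k ∧ k ≤ j.val
  · rw [hb j i h.2 h.1, mul_zero]
  · rw [ha i j h, zero_mul]

/-- The Killing form of `sl(n, ℂ)` as a bilinear form. -/
abbrev KForm (n : ℕ) : LinearMap.BilinForm ℂ (Sl n ℂ) := killingForm ℂ (Sl n ℂ)

lemma KForm_nondegenerate (hn : n ≠ 0) : (KForm n).Nondegenerate := by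
  refine ⟨fun a h => K_nondegenerate hn a h, fun a h => K_nondegenerate hn a fun b => ?_⟩
  rw [K_comm]; exact h b

/-- Every linear functional on `sl(n, ℂ)` is represented by the Killing form. -/
lemma exists_K_eq (hn : n ≠ 0) (φ : Sl n ℂ →ₗ[ℂ] ℂ) : ∃ a : Sl n ℂ, ∀ y, K a y = φ y :=
  ⟨((KForm n).toDual (KForm_nondegenerate hn)).symm φ, fun y =>
    LinearMap.BilinForm.apply_toDual_symm_apply φ y⟩

/-- A functional on a subspace `L` that vanishes on `L ∩ P` is represented by an element that is
orthogonal to `P`. -/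
lemma exists_K_eq_on (hn : n ≠ 0) (L P : Submodule ℂ (Sl n ℂ)) (φ : L →ₗ[ℂ] ℂ)
    (h : ∀ x : L, x.1 ∈ P → φ x = 0) :
    ∃ a : Sl n ℂ, (∀ y : L, K a y.1 = φ y) ∧ ∀ y ∈ P, K a y = 0 := by
  have hφ : φ ∈ (LinearMap.ker (P.mkQ ∘ₗ L.subtype)).dualAnnihilator := by
    rw [Submodule.mem_dualAnnihilator]
    intro x hx
    refine h x ?_
    simpa using hx
  rw [← LinearMap.range_dualMap_eq_dualAnnihilator_ker] at hφ
  obtain ⟨ψ, rfl⟩ := hφ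
  obtain ⟨a, ha⟩ := exists_K_eq hn (ψ ∘ₗ P.mkQ)
  refine ⟨a, fun y => ha _, fun y hy => ?_⟩
  rw [ha, LinearMap.comp_apply, Submodule.mkQ_apply, (Submodule.Quotient.mk_eq_zero P).2 hy,
    map_zero]

end Killing

/-! ### Coefficients of Laurent series in `u⁻¹` -/

section Coefficients

lemma coeff_uPow_mul (a m : ℤ) (f : Laurent) : (uPow a * f).coeff m = f.coeff (m + a) := by
  have h := HahnSeries.coeff_single_mul_add (r := (1 : ℂ)) (x := f) (a := m + a) (b := -a)
  rw [one_mul, add_neg_cancel_right] at h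
  exact h

lemma uPow_add (a b : ℤ) : uPow (a + b) = uPow a * uPow b := by
  rw [uPow, uPow, uPow, HahnSeries.single_mul_single, neg_add, one_mul]

lemma uPow_zero : uPow 0 = 1 := by
  rw [uPow, neg_zero]; rfl

lemma coeff_mul_eq_zero {f g : Laurent} {a b : ℤ} (hf : ∀ m < a, f.coeff m = 0)
    (hg : ∀ m < b, g.coeff m = 0) : ∀ m < a + b, (f * g).coeff m = 0 := by
  intro m hm
  rw [HahnSeries.coeff_mul]
  refine Finset.sum_eq_zero fun ij hij => ?_
  rw [Finset.mem_antidiagonal] at hij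
  by_cases h : ij.1 < a
  · rw [hf _ h, zero_mul]
  · rw [hg ij.2 (by omega), mul_zero]

lemma coeff_ofPS_natCast (f : PowerSeries ℂ) (m : ℕ) :
    (ofPS f).coeff (m : ℤ) = PowerSeries.coeff m f :=
  HahnSeries.ofPowerSeries_apply_coeff f m

lemma coeff_ofPS_of_neg (f : PowerSeries ℂ) {m : ℤ} (hm : m < 0) : (ofPS f).coeff m = 0 := by
  change (HahnSeries.ofPowerSeries ℤ ℂ f).coeff m = 0
  rw [HahnSeries.ofPowerSeries_apply]
  refine HahnSeries.embDomain_of_notMem_range ?_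
  rintro ⟨k, hk⟩
  have : (k : ℤ) = m := hk
  omega

lemma exists_ofPS_eq {f : Laurent} (hf : ∀ m < 0, f.coeff m = 0) :
    ofPS (PowerSeries.mk fun m => f.coeff m) = f := by
  ext m
  rcases lt_or_ge m 0 with h | h
  · rw [coeff_ofPS_of_neg _ h, hf m h]
  · lift m to ℕ using h
    rw [coeff_ofPS_natCast, PowerSeries.coeff_mk]

/-- The inclusion `ℂ[u] → ℂ((u⁻¹))`. -/
def ofPoly : Polynomial ℂ →ₐ[ℂ] Laurent := Polynomial.aeval (uPow 1)

lemma ofPoly_monomial (k : ℕ) (c : ℂ) :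
    ofPoly (Polynomial.monomial k c) = HahnSeries.single (-(k : ℤ)) c := by
  have h : ∀ k : ℕ, uPow 1 ^ k = uPow k := by
    intro k
    induction k with
    | zero => rw [pow_zero, Nat.cast_zero, uPow_zero]
    | succ k ih => rw [pow_succ, ih, Nat.cast_succ, uPow_add]
  rw [ofPoly, Polynomial.aeval_monomial, h, ← Algebra.smul_def, uPow]
  ext m
  simp only [HahnSeries.coeff_smul, HahnSeries.coeff_single]
  split_ifs <;> simp

lemma coeff_ofPoly_neg (f : Polynomial ℂ) (m : ℕ) : (ofPoly f).coeff (-(m : ℤ)) = f.coeff m := by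
  induction f using Polynomial.induction_on' with
  | add p q hp hq => rw [map_add, HahnSeries.coeff_add, hp, hq, Polynomial.coeff_add]
  | monomial k c =>
    rw [ofPoly_monomial, HahnSeries.coeff_single, Polynomial.coeff_monomial]
    simp only [neg_inj, Nat.cast_inj, eq_comm]

lemma coeff_ofPoly_of_pos (f : Polynomial ℂ) {m : ℤ} (hm : 0 < m) : (ofPoly f).coeff m = 0 := by
  induction f using Polynomial.induction_on' with
  | add p q hp hq => rw [map_add, HahnSeries.coeff_add, hp, hq, add_zero]
  | monomial k c => rw [ofPoly_monomial, HahnSeries.coeff_single, if_neg (by omega)]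

/-- The part of a Laurent series in `u⁻¹` that consists of the monomials `u ^ m` with `s ≤ m`. -/
def polyPart (s : ℕ) (f : Laurent) : Polynomial ℂ :=
  ∑ m ∈ Finset.range ((-f.order).toNat + 1),
    Polynomial.monomial m (if s ≤ m then f.coeff (-(m : ℤ)) else 0)

lemma coeff_polyPart (s : ℕ) (f : Laurent) (m : ℕ) :
    (polyPart s f).coeff m = if s ≤ m then f.coeff (-(m : ℤ)) else 0 := by
  rw [polyPart, Polynomial.finsetSum_coeff]
  simp only [Polynomial.coeff_monomial]
  rw [Finset.sum_ite_eq']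
  split_ifs with h1 h2 h2
  · rfl
  · rfl
  · refine (HahnSeries.coeff_eq_zero_of_lt_order ?_).symm
    rw [Finset.mem_range] at h1
    omega
  · rfl

/-- The series `∑ z ^ (m + 1) u ^ (-m) = z u / (u - z)`. -/
def geom (z : ℂ) : Laurent := ofPS (PowerSeries.mk fun m => z ^ (m + 1))

lemma coeff_geom_natCast (z : ℂ) (m : ℕ) : (geom z).coeff (m : ℤ) = z ^ (m + 1) := by
  rw [geom, coeff_ofPS_natCast, PowerSeries.coeff_mk]

lemma coeff_geom_of_neg (z : ℂ) {m : ℤ} (hm : m < 0) : (geom z).coeff m = 0 :=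
  coeff_ofPS_of_neg _ hm

/-- Index `-1` is the coefficient of `u`. The monomial `u^k` with `k ≥ 1` picks `z^k` from the
series, while `k = 0` picks nothing; this loses `f(0)`, which the `ε`-part of `evalVec` restores. -/
lemma coeff_geom_mul_ofPoly (z : ℂ) (f : Polynomial ℂ) :
    (geom z * ofPoly f).coeff (-1) = f.eval z - f.eval 0 := by
  induction f using Polynomial.induction_on' with
  | add p q hp hq =>
    rw [map_add, mul_add, HahnSeries.coeff_add, hp, hq, Polynomial.eval_add, Polynomial.eval_add]
    ring
  | monomial k c =>
    have h := HahnSeries.coeff_mul_single_add (r := c) (x := geom z) (a := -1 + k) (b := -(k : ℤ))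
    rw [add_neg_cancel_right] at h
    rw [ofPoly_monomial, h, Polynomial.eval_monomial, Polynomial.eval_monomial]
    cases k with
    | zero => rw [coeff_geom_of_neg _ (by simp)]; simp
    | succ k =>
      rw [show (-1 + ((k + 1 : ℕ) : ℤ)) = (k : ℤ) by push_cast; ring, coeff_geom_natCast]
      simp; ring

/-- Partial fractions: `geom z = z / (1 - z u⁻¹)`. Both sides are compared after multiplication by
the two denominators, which are nonzero in a domain. -/
lemma geom_mul_geom (z y : ℂ) :
    (z - y) • (geom z * geom y) = (z * y) • (geom z - geom y) := by
  have h : ∀ z : ℂ, (1 - PowerSeries.C z * PowerSeries.X) * (PowerSeries.mk fun m => z ^ (m + 1))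
      = PowerSeries.C z := by
    intro z
    ext m
    rw [sub_mul, one_mul, map_sub, mul_assoc, PowerSeries.coeff_C_mul, PowerSeries.coeff_mk]
    cases m with
    | zero => simp
    | succ m => rw [PowerSeries.coeff_succ_X_mul, PowerSeries.coeff_mk, PowerSeries.coeff_C,
        if_neg (Nat.succ_ne_zero m)]; ring
  have hne : ∀ z : ℂ, (1 - PowerSeries.C z * PowerSeries.X : PowerSeries ℂ) ≠ 0 := by
    intro z h0
    have := congrArg (PowerSeries.coeff 0) h0
    simp at this
  have key : (z - y) • ((PowerSeries.mk fun m => z ^ (m + 1)) * (PowerSeries.mk fun m => y ^ (m + 1)))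
      = (z * y) • ((PowerSeries.mk fun m => z ^ (m + 1)) - (PowerSeries.mk fun m => y ^ (m + 1))) := by
    refine mul_left_cancel₀ (mul_ne_zero (hne z) (hne y)) ?_
    rw [PowerSeries.smul_eq_C_mul, PowerSeries.smul_eq_C_mul, map_sub, map_mul]
    have h1 := h z
    have h2 := h y
    generalize (PowerSeries.mk fun m => z ^ (m + 1)) = Z at *
    generalize (PowerSeries.mk fun m => y ^ (m + 1)) = Y at *
    linear_combination
      (PowerSeries.C z - PowerSeries.C y) * (1 - PowerSeries.C y * PowerSeries.X) * Y * h1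
      + (PowerSeries.C z - PowerSeries.C y) * PowerSeries.C z * h2
      - PowerSeries.C z * PowerSeries.C y * (1 - PowerSeries.C y * PowerSeries.X) * h1
      + PowerSeries.C z * PowerSeries.C y * (1 - PowerSeries.C z * PowerSeries.X) * h2
  have := congrArg ofPS key
  rwa [map_smul, map_smul, map_mul, map_sub] at this

end Coefficients

/-! ### Lattices in `sl(n)((u⁻¹))` -/

section Lattices

variable {n : ℕ}

lemma slMap_apply {R S : Type} [CommRing R] [CommRing S] [Algebra ℂ R] [Algebra ℂ S]
    (f : R →ₗ[ℂ] S) (x : Sl n R) (i j : Fin n) : (slMap n f x).1 i j = f (x.1 i j) := rfl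

lemma slMap_lie {R S : Type} [CommRing R] [CommRing S] [Algebra ℂ R] [Algebra ℂ S]
    (f : R →ₐ[ℂ] S) (x y : Sl n R) :
    slMap n f.toLinearMap ⁅x, y⁆ = ⁅slMap n f.toLinearMap x, slMap n f.toLinearMap y⁆ := by
  apply Subtype.ext
  ext i j
  rw [slMap_apply, sl_lie_val, sl_lie_val]
  simp only [Matrix.sub_apply, Matrix.mul_apply, slMap_apply, AlgHom.toLinearMap_apply, map_sub,
    map_sum, map_mul]

lemma coeff_K (f g : Sl n Laurent) (m : ℤ) :
    (K f g).coeff m = 2 * n * ∑ i, ∑ j, (f.1 i j * g.1 j i).coeff m := by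
  have h : (2 * n * Matrix.trace (f.1 * g.1) : Laurent) = (2 * n) • Matrix.trace (f.1 * g.1) := by
    rw [nsmul_eq_mul]; push_cast; rfl
  rw [K_eq_trace, h, HahnSeries.coeff_nsmul, Pi.smul_apply, nsmul_eq_mul, Matrix.trace]
  push_cast
  simp only [Matrix.diag_apply, Matrix.mul_apply, HahnSeries.coeff_sum]

/-- The lattice of all `f` such that `u ^ (σ i - σ j) f i j` has no monomials `u ^ m` with `m > 0`. -/
def lattice (σ : Fin n → ℤ) : Submodule ℂ (Sl n Laurent) where
  carrier := {f | ∀ i j, ∀ m < σ i - σ j, (f.1 i j).coeff m = 0}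
  add_mem' {f g} hf hg i j m hm := by
    change (f.1 i j + g.1 i j).coeff m = 0
    rw [HahnSeries.coeff_add, hf i j m hm, hg i j m hm, add_zero]
  zero_mem' _ _ _ _ := rfl
  smul_mem' c f hf i j m hm := by
    change (c • f.1 i j).coeff m = 0
    rw [HahnSeries.coeff_smul, hf i j m hm, smul_zero]

lemma lie_mem_lattice {σ : Fin n → ℤ} {f g : Sl n Laurent} (hf : f ∈ lattice σ)
    (hg : g ∈ lattice σ) : ⁅f, g⁆ ∈ lattice σ := by
  have h : ∀ f g : Sl n Laurent, f ∈ lattice σ → g ∈ lattice σ → ∀ i j, ∀ m < σ i - σ j,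
      ((f.1 * g.1) i j).coeff m = 0 := by
    intro f g hf hg i j m hm
    rw [Matrix.mul_apply, HahnSeries.coeff_sum]
    refine Finset.sum_eq_zero fun l _ => coeff_mul_eq_zero (hf i l) (hg l j) m (by omega)
  intro i j m hm
  rw [sl_lie_val, Matrix.sub_apply, HahnSeries.coeff_sub, h f g hf hg i j m hm,
    h g f hg hf i j m hm, sub_zero]

/-- The bounds for `f i j` and `g j i` cancel, so their product has no positive power of `u`. Thus
every such lattice is isotropic for the residue form, `A_k` in particular. -/
lemma coeff_K_lattice {σ : Fin n → ℤ} {f g : Sl n Laurent} (hf : f ∈ lattice σ)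
    (hg : g ∈ lattice σ) : (K f g).coeff (-1) = 0 := by
  rw [coeff_K]
  refine mul_eq_zero_of_right _ (Finset.sum_eq_zero fun i _ => Finset.sum_eq_zero fun j _ => ?_)
  exact coeff_mul_eq_zero (hf i j) (hg j i) _ (by omega)

lemma range_slMap_ofPS :
    LinearMap.range (slMap n ofPS.toLinearMap) = lattice (n := n) fun _ => 0 := by
  ext f
  constructor
  · rintro ⟨s, rfl⟩ i j m hm
    exact coeff_ofPS_of_neg _ (by simpa using hm)
  · intro hf
    have hf' : ∀ i j, ofPS (PowerSeries.mk fun m => (f.1 i j).coeff m) = f.1 i j := fun i j =>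
      exists_ofPS_eq fun m hm => hf i j m (by simpa using hm)
    refine ⟨⟨Matrix.of fun i j => PowerSeries.mk fun m => (f.1 i j).coeff m, ?_⟩, ?_⟩
    · refine LinearMap.mem_ker.2 ?_
      change ∑ i : Fin n, (PowerSeries.mk fun m => (f.1 i i).coeff m) = 0
      ext m
      rw [map_sum]
      simp only [PowerSeries.coeff_mk]
      rw [← HahnSeries.coeff_sum]
      have : ∑ i : Fin n, f.1 i i = 0 := trace_sl f
      rw [this]; rfl
    · apply Subtype.ext
      ext1 i j
      exact hf' i j

/-- The exponents of `u` in `d_k`. -/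
def shift (n k : ℕ) (i : Fin n) : ℤ := if i.val < k then 0 else 1

lemma dMat_eq (n k : ℕ) : dMat n k = Matrix.diagonal fun i => uPow (shift n k i) := by
  rw [dMat]
  congr 1
  ext1 i
  rw [shift]
  split_ifs
  · rw [uPow_zero]
  · rfl

lemma dMat_inv (n k : ℕ) : (dMat n k)⁻¹ = Matrix.diagonal fun i => uPow (-shift n k i) := by
  refine Matrix.inv_eq_left_inv ?_
  rw [dMat_eq, Matrix.diagonal_mul_diagonal, ← Matrix.diagonal_one]
  congr 1
  ext1 i
  rw [← uPow_add, neg_add_cancel, uPow_zero]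

lemma dMat_conj_apply (k : ℕ) (s : Matrix (Fin n) (Fin n) Laurent) (i j : Fin n) :
    ((dMat n k)⁻¹ * s * dMat n k) i j = uPow (shift n k j - shift n k i) * s i j := by
  rw [dMat_inv, dMat_eq, Matrix.mul_diagonal, Matrix.diagonal_mul, sub_eq_add_neg, uPow_add]
  ring

/-- Conjugation by `d_k` multiplies the entry `(i, j)` by `u ^ (shift j - shift i)`, so membership
becomes an entrywise degree bound. -/
lemma order_eq_lattice (n k : ℕ) : order n k = (lattice (shift n k) : Set (Sl n Laurent)) := by
  have hs : ∀ s : Sl n (PowerSeries ℂ), slMap n ofPS.toLinearMap s ∈ lattice fun _ => 0 := by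
    intro s
    rw [← range_slMap_ofPS]
    exact ⟨s, rfl⟩
  ext f
  constructor
  · rintro ⟨s, hf⟩ i j m hm
    rw [hf, dMat_conj_apply, coeff_uPow_mul]
    exact hs s i j _ (by simp only; omega)
  · intro hf
    have : (⟨Matrix.of fun i j => uPow (shift n k i - shift n k j) * f.1 i j, by
        refine LinearMap.mem_ker.2 ?_
        change ∑ i : Fin n, uPow (shift n k i - shift n k i) * f.1 i i = 0
        simp only [sub_self, uPow_zero, one_mul]
        exact trace_sl f⟩ : Sl n Laurent) ∈ LinearMap.range (slMap n ofPS.toLinearMap) := by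
      rw [range_slMap_ofPS]
      intro i j m hm
      change (uPow (shift n k i - shift n k j) * f.1 i j).coeff m = 0
      rw [coeff_uPow_mul]
      exact hf i j _ (by simp only at hm; omega)
    obtain ⟨s, hs⟩ := this
    refine ⟨s, ?_⟩
    ext1 i j
    have h1 : ofPS (s.1 i j) = uPow (shift n k i - shift n k j) * f.1 i j :=
      congrFun (congrFun (congrArg Subtype.val hs) i) j
    rw [dMat_conj_apply, Matrix.map_apply, h1, ← mul_assoc, ← uPow_add]
    simp [uPow_zero]

end Lattices

/-! ### Dual numbers, polynomials and the double -/

section Double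

variable {n : ℕ}

/-- The element `a ⊗ r` of `sl(n, R)`. -/
def tens {R : Type} [CommRing R] [Algebra ℂ R] (r : R) : Sl n ℂ →ₗ[ℂ] Sl n R :=
  slMap n (LinearMap.toSpanSingleton ℂ R r)

lemma tens_apply {R : Type} [CommRing R] [Algebra ℂ R] (r : R) (a : Sl n ℂ) (i j : Fin n) :
    (tens r a).1 i j = a.1 i j • r := rfl

lemma tens_lie {R : Type} [CommRing R] [Algebra ℂ R] [IsScalarTower ℂ R R] [SMulCommClass ℂ R R]
    (r s : R) (a b : Sl n ℂ) :
    ⁅tens r a, tens s b⁆ = tens (r * s) ⁅a, b⁆ := by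
  apply Subtype.ext
  ext i j
  rw [tens_apply, sl_lie_val, sl_lie_val]
  simp only [Matrix.sub_apply, Matrix.mul_apply, tens_apply, smul_mul_smul_comm, sub_smul,
    Finset.sum_smul, mul_comm s r]

/-- The element `x + a ε` of `sl(n, ℂ[ε])`. -/
def dual (x a : Sl n ℂ) : Sl n (DualNumber ℂ) := tens 1 x + tens DualNumber.eps a

@[simp] lemma part₀_dual (x a : Sl n ℂ) : part₀ n (dual x a) = x := by
  apply Subtype.ext
  ext i j
  change (x.1 i j • (1 : DualNumber ℂ) + a.1 i j • DualNumber.eps).fst = x.1 i j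
  simp

@[simp] lemma part₁_dual (x a : Sl n ℂ) : part₁ n (dual x a) = a := by
  apply Subtype.ext
  ext i j
  change (x.1 i j • (1 : DualNumber ℂ) + a.1 i j • DualNumber.eps).snd = a.1 i j
  simp

lemma dual_ext {A B : Sl n (DualNumber ℂ)} (h0 : part₀ n A = part₀ n B)
    (h1 : part₁ n A = part₁ n B) : A = B := by
  apply Subtype.ext
  ext1 i j
  exact TrivSqZeroExt.ext (congrFun (congrFun (congrArg Subtype.val h0) i) j)
    (congrFun (congrFun (congrArg Subtype.val h1) i) j)

lemma part₀_lie (A B : Sl n (DualNumber ℂ)) : part₀ n ⁅A, B⁆ = ⁅part₀ n A, part₀ n B⁆ :=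
  slMap_lie (TrivSqZeroExt.fstHom ℂ ℂ ℂ) A B

lemma part₁_lie (A B : Sl n (DualNumber ℂ)) :
    part₁ n ⁅A, B⁆ = ⁅part₀ n A, part₁ n B⁆ + ⁅part₁ n A, part₀ n B⁆ := by
  apply Subtype.ext
  ext i j
  change ((A.1 * B.1 - B.1 * A.1) i j).snd
    = ((part₀ n A).1 * (part₁ n B).1 - (part₁ n B).1 * (part₀ n A).1
      + ((part₁ n A).1 * (part₀ n B).1 - (part₀ n B).1 * (part₁ n A).1)) i j
  simp only [Matrix.sub_apply, Matrix.add_apply, Matrix.mul_apply, TrivSqZeroExt.snd_sub,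
    TrivSqZeroExt.snd_sum, TrivSqZeroExt.snd_mul, Finset.sum_add_distrib]
  simp only [part₀, part₁, slMap_apply, TrivSqZeroExt.sndHom_apply, AlgHom.toLinearMap_apply,
    TrivSqZeroExt.fstHom_apply, smul_eq_mul, MulOpposite.smul_eq_mul_unop, MulOpposite.unop_op]
  ring

/-- The residue of `u⁻² K` is the coefficient of `u` in `K`, which is stored at index `-1`. -/
lemma Q_apply (x y : Double n) :
    Q n x y = (K x.1 y.1).coeff (-1)
      - K (part₀ n x.2) (part₁ n y.2) - K (part₁ n x.2) (part₀ n y.2) := by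
  change res (uPow (-2) * K x.1 y.1) - _ - _ = _
  rw [res, coeff_uPow_mul]
  rfl

lemma Q_comm (x y : Double n) : Q n x y = Q n y x := by
  rw [Q_apply, Q_apply, K_comm x.1, K_comm (part₀ n x.2), K_comm (part₁ n x.2)]
  ring

lemma Q_lie_left (x y z : Double n) : Q n ⁅x, y⁆ z = Q n x ⁅y, z⁆ := by
  rw [Q_apply, Q_apply]
  change (K ⁅x.1, y.1⁆ z.1).coeff (-1) - K (part₀ n ⁅x.2, y.2⁆) _ - K (part₁ n ⁅x.2, y.2⁆) _
    = (K x.1 ⁅y.1, z.1⁆).coeff (-1) - K _ (part₁ n ⁅y.2, z.2⁆) - K _ (part₀ n ⁅y.2, z.2⁆)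
  rw [part₀_lie, part₀_lie, part₁_lie, part₁_lie, K_lie_left, K_lie_left, K_add_left, K_add_right,
    K_lie_left, K_lie_left]
  ring

/-- The coefficient of `u ^ m` of an element of `sl(n)[u]`. -/
def coef (m : ℕ) : PolySl n →ₗ[ℂ] Sl n ℂ := slMap n (Polynomial.lcoeff ℂ m)

lemma coef_apply (m : ℕ) (c : PolySl n) (i j : Fin n) : (coef m c).1 i j = (c.1 i j).coeff m := rfl

lemma emb_fst_apply (c : PolySl n) (i j : Fin n) : (emb n c).1.1 i j = ofPoly (c.1 i j) := rfl

lemma part₀_emb (c : PolySl n) : part₀ n (emb n c).2 = coef 0 c := by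
  apply Subtype.ext
  ext i j
  change (Polynomial.aeval (DualNumber.eps : DualNumber ℂ) (c.1 i j)).fst = (c.1 i j).coeff 0
  generalize c.1 i j = f
  induction f using Polynomial.induction_on' with
  | add p q hp hq => rw [map_add, TrivSqZeroExt.fst_add, hp, hq, Polynomial.coeff_add]
  | monomial k c =>
    rw [Polynomial.aeval_monomial, Polynomial.coeff_monomial]
    cases k with
    | zero => simp [TrivSqZeroExt.algebraMap_eq_inl]
    | succ k => simp [pow_succ]

lemma part₁_emb (c : PolySl n) : part₁ n (emb n c).2 = coef 1 c := by
  apply Subtype.ext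
  ext i j
  change (Polynomial.aeval (DualNumber.eps : DualNumber ℂ) (c.1 i j)).snd = (c.1 i j).coeff 1
  generalize c.1 i j = f
  induction f using Polynomial.induction_on' with
  | add p q hp hq => rw [map_add, TrivSqZeroExt.snd_add, hp, hq, Polynomial.coeff_add]
  | monomial k c =>
    rw [Polynomial.aeval_monomial, Polynomial.coeff_monomial]
    match k with
    | 0 => simp [TrivSqZeroExt.algebraMap_eq_inl]
    | 1 => simp [TrivSqZeroExt.algebraMap_eq_inl]
    | k + 2 => simp [pow_succ, mul_assoc]

lemma emb_lie (c d : PolySl n) : emb n ⁅c, d⁆ = ⁅emb n c, emb n d⁆ :=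
  Prod.ext (slMap_lie _ c d) (slMap_lie _ c d)

/-- The coefficient of `u` in `K(c, d)` is `K(c₀, d₁) + K(c₁, d₀)`, which is what the `ε`-part of
`Q` subtracts. -/
lemma Q_emb_emb (c d : PolySl n) : Q n (emb n c) (emb n d) = 0 := by
  rw [Q_apply, part₀_emb, part₁_emb, part₀_emb, part₁_emb, coeff_K, K_eq_trace, K_eq_trace,
    Matrix.trace, Matrix.trace]
  simp only [Matrix.diag_apply, Matrix.mul_apply, coef_apply, emb_fst_apply, ← map_mul]
  have h : ∀ f : Polynomial ℂ, (ofPoly f).coeff (-1) = f.coeff 1 := fun f => coeff_ofPoly_neg f 1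
  simp only [h, Polynomial.coeff_mul, Finset.Nat.antidiagonal_succ, Finset.Nat.antidiagonal_zero,
    Finset.sum_cons, Finset.map_singleton, Finset.sum_singleton, Finset.sum_add_distrib]
  simp
  ring

lemma mem_dualP {w : Double n} :
    w ∈ dualP n ↔ w.1 ∈ lattice (fun _ : Fin n => (0 : ℤ)) ∧ part₀ n w.2 = 0 := by
  rw [dualP, Submodule.mem_prod, range_slMap_ofPS, LinearMap.mem_ker]

lemma Q_dualP {w w' : Double n} (hw : w ∈ dualP n) (hw' : w' ∈ dualP n) : Q n w w' = 0 := by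
  rw [mem_dualP] at hw hw'
  rw [Q_apply, coeff_K_lattice hw.1 hw'.1, hw.2, hw'.2, K_zero_left, K_zero_right]
  ring

/-- A polynomial matrix that agrees with `f` in the monomials `u ^ m`, `s i j ≤ m`, of the
entries. -/
lemma exists_polyPart (s : Fin n → Fin n → ℕ) (s0 : ℕ) (hs : ∀ i, s i i = s0) (f : Sl n Laurent) :
    ∃ c : PolySl n, ∀ i j m,
      (c.1 i j).coeff m = if s i j ≤ m then (f.1 i j).coeff (-(m : ℤ)) else 0 := by
  -- Truncation keeps the trace zero because all diagonal entries are cut at the same degree `s0`.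
  refine ⟨⟨Matrix.of fun i j => polyPart (s i j) (f.1 i j), ?_⟩, fun i j m => coeff_polyPart _ _ _⟩
  refine LinearMap.mem_ker.2 ?_
  change ∑ i : Fin n, polyPart (s i i) (f.1 i i) = 0
  ext m
  rw [Polynomial.finsetSum_coeff]
  simp only [coeff_polyPart, hs]
  split_ifs
  · rw [← HahnSeries.coeff_sum]
    have : ∑ i : Fin n, f.1 i i = 0 := trace_sl f
    rw [this]; rfl
  · simp

/-- The coefficients of `u ^ l ⊗ a`. -/
lemma coef_tens (m l : ℕ) (a : Sl n ℂ) :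
    coef m (tens (Polynomial.X ^ l : Polynomial ℂ) a) = if m = l then a else 0 := by
  apply Subtype.ext
  ext i j
  rw [coef_apply, tens_apply, Polynomial.coeff_smul, Polynomial.coeff_X_pow]
  split_ifs <;> simp

/-- The double is the sum of `i(P)` and `P*`. -/
lemma exists_sub_emb_mem_dualP (x : Double n) : ∃ c : PolySl n, x - emb n c ∈ dualP n := by
  obtain ⟨c, hc⟩ := exists_polyPart (fun _ _ => 1) 1 (fun _ => rfl) x.1
  -- The polynomial `c` removes the powers `u^m`, `m ≥ 1`. The constant term is free, since `P*`
  -- allows one in the series, and is chosen to cancel `A₀`.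
  refine ⟨c + tens (Polynomial.X ^ 0) (part₀ n x.2), ?_⟩
  have hc0 : coef 0 c = 0 := by
    apply Subtype.ext
    ext i j
    rw [coef_apply, hc]
    rfl
  rw [mem_dualP]
  constructor
  · intro i j m hm
    simp only [sub_self] at hm
    obtain ⟨l, rfl⟩ : ∃ l : ℕ, m = -((l + 1 : ℕ) : ℤ) := ⟨(-m - 1).toNat, by omega⟩
    change (x.1.1 i j - ofPoly (c.1 i j + (part₀ n x.2).1 i j • Polynomial.X ^ 0)).coeff _ = 0
    rw [HahnSeries.coeff_sub, coeff_ofPoly_neg, Polynomial.coeff_add, hc]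
    simp [Polynomial.coeff_one]
  · rw [Prod.snd_sub, map_sub, part₀_emb, map_add, hc0, coef_tens]
    simp

end Double

/-! ### Evaluation functionals are represented by elements of `P*` -/

section Evaluation

variable {n : ℕ}

lemma part₀_tens_eps (a : Sl n ℂ) : part₀ n (tens DualNumber.eps a) = 0 := by
  apply Subtype.ext
  ext i j
  change (a.1 i j • DualNumber.eps : DualNumber ℂ).fst = 0
  simp

lemma part₁_tens_eps (a : Sl n ℂ) : part₁ n (tens DualNumber.eps a) = a := by
  apply Subtype.ext
  ext i j
  change (a.1 i j • DualNumber.eps : DualNumber ℂ).snd = a.1 i j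
  simp

/-- The element of `P*` that represents the functional `c ↦ K(a, c(z))` on `P`. -/
def evalVec (z : ℂ) : Sl n ℂ →ₗ[ℂ] Double n := (tens (geom z)).prod (-tens DualNumber.eps)

lemma evalVec_fst (z : ℂ) (a : Sl n ℂ) : (evalVec z a).1 = tens (geom z) a := rfl

lemma evalVec_snd (z : ℂ) (a : Sl n ℂ) : (evalVec z a).2 = -tens DualNumber.eps a := rfl

lemma evalVec_mem_dualP (z : ℂ) (a : Sl n ℂ) : evalVec z a ∈ dualP n := by
  rw [mem_dualP, evalVec_fst, evalVec_snd, map_neg, part₀_tens_eps, neg_zero]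
  refine ⟨fun i j m hm => ?_, rfl⟩
  rw [tens_apply, HahnSeries.coeff_smul, coeff_geom_of_neg z (by simpa using hm), smul_zero]

lemma evalAt_apply (z : ℂ) (c : PolySl n) (i j : Fin n) :
    (evalAt n z c).1 i j = (c.1 i j).eval z := by
  rw [evalAt, slMap_apply]
  exact (Polynomial.aeval_def _ _).trans (by simp [Polynomial.eval₂_eq_eval_map])

/-- The residue contributes `K(a, c(z) - c(0))` and the `ε`-part contributes the missing `K(a,
c(0))`. -/
lemma Q_evalVec_emb (z : ℂ) (a : Sl n ℂ) (c : PolySl n) :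
    Q n (evalVec z a) (emb n c) = K a (evalAt n z c) := by
  rw [Q_apply, part₀_emb, part₁_emb, evalVec_fst, evalVec_snd, map_neg, map_neg, part₀_tens_eps,
    part₁_tens_eps, neg_zero, K_zero_left, K_neg_left, coeff_K, sub_zero, sub_neg_eq_add,
    K_eq_trace, K_eq_trace, ← mul_add, Matrix.trace, Matrix.trace]
  congr 1
  rw [← Finset.sum_add_distrib]
  refine Finset.sum_congr rfl fun i _ => ?_
  rw [Matrix.diag_apply, Matrix.diag_apply, Matrix.mul_apply, Matrix.mul_apply,
    ← Finset.sum_add_distrib]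
  refine Finset.sum_congr rfl fun j _ => ?_
  rw [tens_apply, emb_fst_apply, smul_mul_assoc, HahnSeries.coeff_smul, coeff_geom_mul_ofPoly,
    coef_apply, evalAt_apply, Polynomial.coeff_zero_eq_eval_zero, smul_eq_mul]
  ring

/-- Partial fractions in the series component; both sides vanish in the other because `ε² = 0`. The
scalar matches, up to sign, the singular coefficient of the r-matrix. -/
lemma evalVec_lie {z y : ℂ} (h : z ≠ y) (a b : Sl n ℂ) :
    ⁅evalVec z a, evalVec y b⁆ = (z * y / (z - y)) • (evalVec z ⁅a, b⁆ - evalVec y ⁅a, b⁆) := by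
  refine Prod.ext ?_ ?_
  · change ⁅tens (geom z) a, tens (geom y) b⁆
      = (z * y / (z - y)) • (tens (geom z) ⁅a, b⁆ - tens (geom y) ⁅a, b⁆)
    have hg : geom z * geom y = (z * y / (z - y)) • (geom z - geom y) := by
      rw [div_eq_inv_mul, mul_smul, ← geom_mul_geom, inv_smul_smul₀ (sub_ne_zero.2 h)]
    rw [tens_lie, hg]
    apply Subtype.ext
    ext1 i j
    change _ = (z * y / (z - y)) • ((tens (geom z) ⁅a, b⁆).1 i j - (tens (geom y) ⁅a, b⁆).1 i j)
    simp only [tens_apply]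
    rw [smul_comm, smul_sub (M := ℂ) (A := Laurent)]
  · change ⁅-tens DualNumber.eps a, -tens DualNumber.eps b⁆
      = (z * y / (z - y)) • (-tens DualNumber.eps ⁅a, b⁆ - -tens DualNumber.eps ⁅a, b⁆)
    rw [sub_self, smul_zero, neg_lie, lie_neg, neg_neg, tens_lie, DualNumber.eps_mul_eps]
    apply Subtype.ext
    ext1 i j
    rw [tens_apply, smul_zero]
    rfl

/-- An element of `sl(n)[u]` that vanishes at all but finitely many points is zero. -/
lemma eq_zero_of_evalAt (s : Finset ℂ) (c : PolySl n) (h : ∀ z ∉ s, evalAt n z c = 0) : c = 0 := by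
  apply Subtype.ext
  ext1 i j
  change c.1 i j = 0
  refine Polynomial.eq_zero_of_infinite_isRoot _ ?_
  refine Set.Infinite.mono (fun z (hz : z ∈ (↑s : Set ℂ)ᶜ) => ?_) s.finite_toSet.infinite_compl
  change (c.1 i j).eval z = 0
  rw [← evalAt_apply, h z hz]
  rfl

/-- The finite exceptional set `s` is what allows the diagonals, where the Yang–Baxter equation says
nothing, to be avoided. -/
lemma eq_zero_of_Q_evalVec (hn : n ≠ 0) (s : Finset ℂ) (c : PolySl n)
    (h : ∀ z ∉ s, ∀ a, Q n (evalVec z a) (emb n c) = 0) : c = 0 := by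
  refine eq_zero_of_evalAt s c fun z hz => K_nondegenerate hn _ fun a => ?_
  rw [K_comm, ← Q_evalVec_emb, h z hz a]

lemma emb_mem_dualP (hn : n ≠ 0) {c : PolySl n} (h : emb n c ∈ dualP n) : c = 0 :=
  eq_zero_of_Q_evalVec hn ∅ c fun z _ a => Q_dualP (evalVec_mem_dualP z a) h

end Evaluation

/-! ### Graphs of skew maps `P* → P` -/

section Graph

variable {n : ℕ}

lemma contract_tmul (a b : PolySl n) (w : Double n) :
    contract (a ⊗ₜ[ℂ] b) w = Q n w (emb n a) • b := by
  change TensorProduct.lid ℂ _ (LinearMap.rTensor _ _ (a ⊗ₜ[ℂ] b)) = _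
  rw [LinearMap.rTensor_tmul, TensorProduct.lid_tmul]
  rfl

lemma contract_add (p p' : PolySl n ⊗[ℂ] PolySl n) (w : Double n) :
    contract (p + p') w = contract p w + contract p' w := by
  change TensorProduct.lid ℂ _ (LinearMap.rTensor _ _ (p + p')) = _
  rw [map_add, map_add]
  rfl

lemma contract_zero (w : Double n) : contract (0 : PolySl n ⊗[ℂ] PolySl n) w = 0 := by
  change TensorProduct.lid ℂ _ (LinearMap.rTensor (PolySl n) (Q n w ∘ₗ emb n) 0) = _
  rw [map_zero, map_zero]

lemma contract_neg (p : PolySl n ⊗[ℂ] PolySl n) (w : Double n) :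
    contract (-p) w = -contract p w := by
  change TensorProduct.lid ℂ _ (LinearMap.rTensor _ _ (-p)) = _
  rw [map_neg, map_neg]
  rfl

/-- Swapping the tensor factors transposes the associated map, so a skew tensor gives a skew map. -/
lemma Q_emb_contract_comm (p : PolySl n ⊗[ℂ] PolySl n) (w w' : Double n) :
    Q n w' (emb n (contract (TensorProduct.comm ℂ _ _ p) w)) = Q n w (emb n (contract p w')) := by
  induction p using TensorProduct.induction_on with
  | zero => simp only [map_zero, contract_zero]
  | tmul a b =>
    rw [TensorProduct.comm_tmul, contract_tmul, contract_tmul, map_smul, map_smul, map_smul,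
      map_smul, smul_eq_mul, smul_eq_mul, mul_comm]
  | add p p' hp hp' => simp only [map_add, contract_add, hp, hp']

/-- The graph of the map `P* → P` defined by `p`. -/
def graph (p : PolySl n ⊗[ℂ] PolySl n) : Submodule ℂ (Double n) :=
  (dualP n).map (LinearMap.id + emb n ∘ₗ contract p)

lemma mem_graph {p : PolySl n ⊗[ℂ] PolySl n} {x : Double n} :
    x ∈ graph p ↔ ∃ w ∈ dualP n, w + emb n (contract p w) = x := Iff.rfl

variable {p : PolySl n ⊗[ℂ] PolySl n}

lemma Q_emb_contract_skew (hp : TensorProduct.comm ℂ (PolySl n) (PolySl n) p = -p)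
    (w w' : Double n) : Q n w' (emb n (contract p w)) = -Q n w (emb n (contract p w')) := by
  rw [← Q_emb_contract_comm p w w', hp, contract_neg, map_neg, map_neg, neg_neg]

lemma Q_add_add (x x' y y' : Double n) :
    Q n (x + x') (y + y') = Q n x y + Q n x y' + (Q n x' y + Q n x' y') := by
  rw [map_add (Q n) x x', LinearMap.add_apply, map_add, map_add]

lemma Q_graph (hp : TensorProduct.comm ℂ (PolySl n) (PolySl n) p = -p) {x y : Double n}
    (hx : x ∈ graph p) (hy : y ∈ graph p) : Q n x y = 0 := by
  obtain ⟨w, hw, rfl⟩ := mem_graph.1 hx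
  obtain ⟨w', hw', rfl⟩ := mem_graph.1 hy
  rw [Q_add_add, Q_dualP hw hw', Q_emb_emb,
    Q_emb_contract_skew hp w' w, Q_comm (emb n _) w']
  ring

/-- The graph is maximal isotropic; it suffices to test against the evaluation vectors. -/
lemma mem_graph_of_evalVec (hn : n ≠ 0)
    (hp : TensorProduct.comm ℂ (PolySl n) (PolySl n) p = -p) (s : Finset ℂ) {x : Double n}
    (h : ∀ z ∉ s, ∀ a, Q n (evalVec z a + emb n (contract p (evalVec z a))) x = 0) :
    x ∈ graph p := by
  obtain ⟨c, hc⟩ := exists_sub_emb_mem_dualP x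
  have hx : x = (x - emb n c) + emb n c := (sub_add_cancel _ _).symm
  generalize x - emb n c = w at hc hx
  subst hx
  refine mem_graph.2 ⟨w, hc, ?_⟩
  congr 2
  -- By skewness, pairing `w + i(c)` with the lift of an evaluation vector evaluates the difference
  -- of `c` and the image of `w`.
  refine (sub_eq_zero.1 (eq_zero_of_Q_evalVec hn s _ fun z hz a => ?_)).symm
  have h1 := h z hz a
  rw [Q_add_add, Q_dualP (evalVec_mem_dualP z a) hc,
    Q_emb_emb, Q_comm _ w, Q_emb_contract_skew hp _ w] at h1
  rw [map_sub, map_sub]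
  linear_combination h1

lemma mem_graph_of_Q (hn : n ≠ 0) (hp : TensorProduct.comm ℂ (PolySl n) (PolySl n) p = -p)
    {x : Double n} (h : ∀ y ∈ graph p, Q n y x = 0) : x ∈ graph p :=
  mem_graph_of_evalVec hn hp ∅ fun z _ a => h _ ⟨_, evalVec_mem_dualP z a, rfl⟩

/-- The component of such an element in `P*` lies in `P* ∩ i(P) = 0`. -/
lemma emb_mem_graph (hn : n ≠ 0) {c : PolySl n} (h : emb n c ∈ graph p) : c = 0 := by
  obtain ⟨w, hw, h⟩ := mem_graph.1 h
  have h1 : emb n (c - contract p w) = w := by rw [map_sub, ← h, add_sub_cancel_right]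
  have h2 : c - contract p w = 0 := emb_mem_dualP hn (by rw [h1]; exact hw)
  have h3 : w = 0 := by rw [← h1, h2, map_zero]
  rw [h3, map_zero, sub_zero] at h2
  exact h2

lemma contract_eq_of_graph_eq (hn : n ≠ 0) {p' : PolySl n ⊗[ℂ] PolySl n}
    (h : graph p = graph p') {w : Double n} (hw : w ∈ dualP n) : contract p w = contract p' w := by
  have h1 : w + emb n (contract p w) ∈ graph p' := h ▸ mem_graph.2 ⟨w, hw, rfl⟩
  have h2 : w + emb n (contract p' w) ∈ graph p' := mem_graph.2 ⟨w, hw, rfl⟩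
  have h3 := sub_mem h1 h2
  rw [add_sub_add_left_eq_sub, ← map_sub] at h3
  exact sub_eq_zero.1 (emb_mem_graph hn h3)

end Graph

/-! ### Separating functionals on tensor products -/

section Separation

variable {V W : Type} [AddCommGroup V] [Module ℂ V] [AddCommGroup W] [Module ℂ W]

/-- In a basis of `W` the tensor has coordinates in `V`, and each `φ i` acts on them one by one; no
finiteness is needed. -/
lemma tensor_eq_zero_of_left {ι : Type} (φ : ι → V →ₗ[ℂ] ℂ)
    (hφ : ∀ v, (∀ i, φ i v = 0) → v = 0) (t : V ⊗[ℂ] W)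
    (h : ∀ i, LinearMap.rTensor W (φ i) t = 0) : t = 0 := by
  classical
  let b := Module.Basis.ofVectorSpace ℂ W
  have key : ∀ (i : ι) (t : V ⊗[ℂ] W) (k : _),
      TensorProduct.equivFinsuppOfBasisRight b (LinearMap.rTensor W (φ i) t) k
        = φ i (TensorProduct.equivFinsuppOfBasisRight b t k) := by
    intro i t k
    induction t using TensorProduct.induction_on with
    | zero => simp
    | tmul v w => simp
    | add t t' ht ht' => simp only [map_add, Finsupp.add_apply, ht, ht']
  refine (TensorProduct.equivFinsuppOfBasisRight b).injective ?_
  rw [map_zero]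
  ext1 k
  refine hφ _ fun i => ?_
  rw [← key, h i, map_zero]
  rfl

lemma tensor_eq_zero {ι κ : Type} (φ : ι → V →ₗ[ℂ] ℂ)
    (hφ : ∀ v, (∀ i, φ i v = 0) → v = 0) (ψ : κ → W →ₗ[ℂ] ℂ)
    (hψ : ∀ w, (∀ i, ψ i w = 0) → w = 0) (t : V ⊗[ℂ] W)
    (h : ∀ i k, TensorProduct.lift ((LinearMap.mul ℂ ℂ).compl₁₂ (φ i) (ψ k)) t = 0) : t = 0 := by
  refine tensor_eq_zero_of_left φ hφ t fun i => ?_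
  refine (TensorProduct.lid ℂ W).injective ?_
  rw [map_zero]
  refine hψ _ fun k => ?_
  rw [← h i k]
  generalize t = t
  induction t using TensorProduct.induction_on with
  | zero => simp
  | tmul v w => simp
  | add t t' ht ht' => simp only [map_add, ht, ht']

end Separation

/-! ### Contractions with the Killing form -/

section Contractions

variable {n : ℕ}

/-- `x ⊗ y ↦ K(a, x) y`. -/
def leftC (a : Sl n ℂ) : Sl n ℂ ⊗[ℂ] Sl n ℂ →ₗ[ℂ] Sl n ℂ :=
  (TensorProduct.lid ℂ (Sl n ℂ)).toLinearMap ∘ₗ LinearMap.rTensor (Sl n ℂ) (KForm n a)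

/-- `x ⊗ y ↦ K(a, y) x`. -/
def rightC (a : Sl n ℂ) : Sl n ℂ ⊗[ℂ] Sl n ℂ →ₗ[ℂ] Sl n ℂ :=
  (TensorProduct.rid ℂ (Sl n ℂ)).toLinearMap ∘ₗ LinearMap.lTensor (Sl n ℂ) (KForm n a)

lemma leftC_tmul (a x y : Sl n ℂ) : leftC a (x ⊗ₜ[ℂ] y) = K a x • y := by
  rw [leftC, LinearMap.comp_apply, LinearMap.rTensor_tmul]
  exact TensorProduct.lid_tmul _ _

lemma rightC_tmul (a x y : Sl n ℂ) : rightC a (x ⊗ₜ[ℂ] y) = K a y • x := by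
  rw [rightC, LinearMap.comp_apply, LinearMap.lTensor_tmul]
  exact TensorProduct.rid_tmul _ _

lemma leftC_comm (a : Sl n ℂ) (t : Sl n ℂ ⊗[ℂ] Sl n ℂ) :
    leftC a (TensorProduct.comm ℂ _ _ t) = rightC a t := by
  induction t using TensorProduct.induction_on with
  | zero => simp
  | tmul x y => rw [TensorProduct.comm_tmul, leftC_tmul, rightC_tmul]
  | add t t' ht ht' => simp only [map_add, ht, ht']

/-- The Gram matrix of the Killing form with respect to the basis that defines `casimir n`. -/
def gram (n : ℕ) : Matrix (Fin (Module.finrank ℂ (Sl n ℂ))) (Fin (Module.finrank ℂ (Sl n ℂ))) ℂ :=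
  Matrix.of fun i j => K (Module.finBasis ℂ (Sl n ℂ) i) (Module.finBasis ℂ (Sl n ℂ) j)

lemma casimir_eq (n : ℕ) : casimir n = ∑ i, ∑ j, (gram n)⁻¹ i j •
    (Module.finBasis ℂ (Sl n ℂ) i ⊗ₜ[ℂ] Module.finBasis ℂ (Sl n ℂ) j) := rfl

lemma gram_transpose (n : ℕ) : (gram n).transpose = gram n := by
  ext i j
  exact K_comm _ _

lemma gram_inv_mul (hn : n ≠ 0) : (gram n)⁻¹ * gram n = 1 := by
  refine Matrix.nonsing_inv_mul _ ?_
  have h := (LinearMap.BilinForm.nondegenerate_iff_det_ne_zero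
    (Module.finBasis ℂ (Sl n ℂ))).1 (KForm_nondegenerate hn)
  have hG : LinearMap.BilinForm.toMatrix (Module.finBasis ℂ (Sl n ℂ)) (KForm n) = gram n := by
    ext i j
    rw [LinearMap.BilinForm.toMatrix_apply]
    rfl
  rw [hG] at h
  exact isUnit_iff_ne_zero.2 h

/-- The Casimir element represents the identity map: on a basis vector the sum is a column of `G⁻¹
G`, the Gram matrix being symmetric. -/
lemma rightC_casimir (hn : n ≠ 0) (a : Sl n ℂ) : rightC a (casimir n) = a := by
  have h : ∑ i, ∑ j, (gram n)⁻¹ i j • ((KForm n).flip (Module.finBasis ℂ (Sl n ℂ) j)).smulRight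
      (Module.finBasis ℂ (Sl n ℂ) i) = LinearMap.id := by
    refine (Module.finBasis ℂ (Sl n ℂ)).ext fun k => ?_
    have h1 : ∀ i, ∑ j, (gram n)⁻¹ i j * gram n k j = (1 : Matrix _ _ ℂ) i k := by
      intro i
      rw [← gram_inv_mul hn, Matrix.mul_apply]
      refine Finset.sum_congr rfl fun j _ => ?_
      rw [← Matrix.transpose_apply (gram n), gram_transpose]
    simp only [LinearMap.sum_apply, LinearMap.smul_apply, LinearMap.smulRight_apply,
      smul_smul, ← Finset.sum_smul, LinearMap.id_apply]
    refine (Finset.sum_congr rfl fun i _ => congrArg (· • _) (h1 i)).trans ?_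
    simp [Matrix.one_apply]
  rw [casimir_eq]
  refine Eq.trans ?_ (LinearMap.congr_fun h a)
  simp only [map_sum, map_smul, rightC_tmul, LinearMap.sum_apply, LinearMap.smul_apply,
    LinearMap.smulRight_apply]
  rfl

lemma comm_casimir (n : ℕ) :
    TensorProduct.comm ℂ (Sl n ℂ) (Sl n ℂ) (casimir n) = casimir n := by
  rw [casimir_eq]
  simp only [map_sum, map_smul, TensorProduct.comm_tmul]
  rw [Finset.sum_comm]
  refine Finset.sum_congr rfl fun i _ => Finset.sum_congr rfl fun j _ => ?_
  congr 1
  rw [← Matrix.transpose_apply (gram n)⁻¹, Matrix.transpose_nonsing_inv, gram_transpose]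

lemma leftC_casimir (hn : n ≠ 0) (a : Sl n ℂ) : leftC a (casimir n) = a := by
  rw [← comm_casimir, leftC_comm, rightC_casimir hn]

/-- `x ⊗ y ⊗ z ↦ K(a, x) K(b, y) K(c, z)`. -/
def tri (a b c : Sl n ℂ) : Sl n ℂ ⊗[ℂ] (Sl n ℂ ⊗[ℂ] Sl n ℂ) →ₗ[ℂ] ℂ :=
  TensorProduct.lift ((LinearMap.mul ℂ ℂ).compl₁₂ (KForm n a)
    (TensorProduct.lift ((LinearMap.mul ℂ ℂ).compl₁₂ (KForm n b) (KForm n c))))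

lemma eq_zero_of_tri (hn : n ≠ 0) (t : Sl n ℂ ⊗[ℂ] (Sl n ℂ ⊗[ℂ] Sl n ℂ))
    (h : ∀ a b c, tri a b c t = 0) : t = 0 := by
  have hK : ∀ x : Sl n ℂ, (∀ a, KForm n a x = 0) → x = 0 := fun x hx =>
    K_nondegenerate hn x fun a => by rw [K_comm]; exact hx a
  refine tensor_eq_zero (fun a => KForm n a) hK
    (fun bc : Sl n ℂ × Sl n ℂ => TensorProduct.lift
      ((LinearMap.mul ℂ ℂ).compl₁₂ (KForm n bc.1) (KForm n bc.2))) ?_ t fun a bc => h a bc.1 bc.2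
  exact fun t' ht' => tensor_eq_zero (fun a => KForm n a) hK (fun a => KForm n a) hK t'
    fun b c => ht' (b, c)

/-- Only the shared slot carries a bracket, so the other slot of each tensor may be contracted
first. This turns the Yang–Baxter terms into brackets in `sl(n)`. -/
lemma tri_br₁₂₁₃ (a b c : Sl n ℂ) (r s : Sl n ℂ ⊗[ℂ] Sl n ℂ) :
    tri a b c (br₁₂₁₃ r s) = K a ⁅rightC b r, rightC c s⁆ := by
  induction r using TensorProduct.induction_on with
  | zero => simp [br₁₂₁₃, K_zero_right]
  | add r r' hr hr' =>
    rw [map_add, add_lie, K_add_right, ← hr, ← hr', ← map_add]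
    simp only [br₁₂₁₃, map_add, LinearMap.add_apply]
  | tmul x y =>
    induction s using TensorProduct.induction_on with
    | zero => simp [br₁₂₁₃, K_zero_right]
    | add s s' hs hs' =>
      rw [map_add, lie_add, K_add_right, ← hs, ← hs', ← map_add]
      simp only [br₁₂₁₃, map_add]
    | tmul x' y' =>
      rw [rightC_tmul, rightC_tmul, smul_lie, lie_smul, K_smul_right, K_smul_right, smul_eq_mul,
        smul_eq_mul]
      change K a ⁅x, x'⁆ * (K b y * K c y') = _
      ring

lemma tri_br₁₂₂₃ (a b c : Sl n ℂ) (r s : Sl n ℂ ⊗[ℂ] Sl n ℂ) :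
    tri a b c (br₁₂₂₃ r s) = K b ⁅leftC a r, rightC c s⁆ := by
  induction r using TensorProduct.induction_on with
  | zero => simp [br₁₂₂₃, K_zero_right]
  | add r r' hr hr' =>
    rw [map_add, add_lie, K_add_right, ← hr, ← hr', ← map_add]
    simp only [br₁₂₂₃, map_add, TensorProduct.add_tmul]
  | tmul x y =>
    induction s using TensorProduct.induction_on with
    | zero => simp [br₁₂₂₃, K_zero_right]
    | add s s' hs hs' =>
      rw [map_add, lie_add, K_add_right, ← hs, ← hs', ← map_add]
      simp only [br₁₂₂₃, map_add, TensorProduct.tmul_add]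
    | tmul x' y' =>
      rw [rightC_tmul, leftC_tmul, smul_lie, lie_smul, K_smul_right, K_smul_right, smul_eq_mul,
        smul_eq_mul]
      change K a x * (K b ⁅y, x'⁆ * K c y') = _
      ring

lemma tri_br₁₃₂₃ (a b c : Sl n ℂ) (r s : Sl n ℂ ⊗[ℂ] Sl n ℂ) :
    tri a b c (br₁₃₂₃ r s) = K c ⁅leftC a r, leftC b s⁆ := by
  induction r using TensorProduct.induction_on with
  | zero => simp [br₁₃₂₃, K_zero_right]
  | add r r' hr hr' =>
    rw [map_add, add_lie, K_add_right, ← hr, ← hr', ← map_add]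
    simp only [br₁₃₂₃, map_add, LinearMap.add_apply]
  | tmul x y =>
    induction s using TensorProduct.induction_on with
    | zero => simp [br₁₃₂₃, K_zero_right]
    | add s s' hs hs' =>
      rw [map_add, lie_add, K_add_right, ← hs, ← hs', ← map_add]
      simp only [br₁₃₂₃, map_add]
    | tmul x' y' =>
      rw [leftC_tmul, leftC_tmul, smul_lie, lie_smul, K_smul_right, K_smul_right, smul_eq_mul,
        smul_eq_mul]
      change K a x * (K b x' * K c ⁅y, y'⁆) = _
      ring

/-- The bridge between values of `p(u, v)` and the map `P* → P`: contracting at `u` is pairing with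
`evalVec u a`. -/
lemma leftC_map_evalAt (p : PolySl n ⊗[ℂ] PolySl n) (u v : ℂ) (a : Sl n ℂ) :
    leftC a (TensorProduct.map (evalAt n u) (evalAt n v) p)
      = evalAt n v (contract p (evalVec u a)) := by
  induction p using TensorProduct.induction_on with
  | zero => simp only [map_zero, contract_zero]
  | add p p' hp hp' => simp only [map_add, contract_add, hp, hp']
  | tmul x y => rw [TensorProduct.map_tmul, leftC_tmul, contract_tmul, map_smul, Q_evalVec_emb]

lemma rightC_map_evalAt {p : PolySl n ⊗[ℂ] PolySl n}
    (hp : TensorProduct.comm ℂ (PolySl n) (PolySl n) p = -p) (u v : ℂ) (a : Sl n ℂ) :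
    rightC a (TensorProduct.map (evalAt n u) (evalAt n v) p)
      = -evalAt n u (contract p (evalVec v a)) := by
  rw [← leftC_comm, ← TensorProduct.map_comm, leftC_map_evalAt, hp, contract_neg, map_neg]

lemma leftC_rFun (hn : n ≠ 0) (p : PolySl n ⊗[ℂ] PolySl n) (u v : ℂ) (a : Sl n ℂ) :
    leftC a (rFun p u v) = (u * v / (v - u)) • a + evalAt n v (contract p (evalVec u a)) := by
  rw [rFun, map_add, map_smul, leftC_casimir hn, leftC_map_evalAt]

lemma rightC_rFun (hn : n ≠ 0) {p : PolySl n ⊗[ℂ] PolySl n}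
    (hp : TensorProduct.comm ℂ (PolySl n) (PolySl n) p = -p) (u v : ℂ) (a : Sl n ℂ) :
    rightC a (rFun p u v) = (u * v / (v - u)) • a - evalAt n u (contract p (evalVec v a)) := by
  rw [rFun, map_add, map_smul, rightC_casimir hn, rightC_map_evalAt hp, ← sub_eq_add_neg]

end Contractions

/-! ### The classical Yang-Baxter equation says that the graph is a subalgebra -/

section YangBaxter

variable {n : ℕ}

lemma evalAt_lie (z : ℂ) (c d : PolySl n) :
    evalAt n z ⁅c, d⁆ = ⁅evalAt n z c, evalAt n z d⁆ := slMap_lie _ c d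

lemma K_lie_rotate (x y z : Sl n ℂ) : K x ⁅y, z⁆ = K ⁅z, x⁆ y := by
  rw [← K_lie_left, K_comm, ← K_lie_left]

lemma K_lie_swap_left (x y z : Sl n ℂ) : K ⁅x, y⁆ z = -K ⁅y, x⁆ z := by
  rw [← K_neg_left, lie_skew]

lemma K_lie_swap_right (x y z : Sl n ℂ) : K x ⁅y, z⁆ = -K x ⁅z, y⁆ := by
  rw [← K_neg_right, lie_skew]

lemma K_smul_add_lie_smul_add (a b c x y : Sl n ℂ) (α β : ℂ) :
    K a ⁅α • b + x, β • c + y⁆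
      = α * β * K a ⁅b, c⁆ + α * K ⁅a, b⁆ y + β * K ⁅c, a⁆ x + K a ⁅x, y⁆ := by
  rw [add_lie, lie_add, lie_add, K_add_right, K_add_right, K_add_right, smul_lie, smul_lie,
    lie_smul, lie_smul, K_smul_right, K_smul_right, K_smul_right, K_smul_right, K_lie_left,
    ← K_lie_rotate]
  simp only [smul_eq_mul]
  ring

lemma Q_lie_rotate (x y z : Double n) : Q n ⁅x, y⁆ z = Q n ⁅z, x⁆ y := by
  rw [Q_lie_left x, Q_comm _ y, ← Q_lie_left y, Q_comm _ x]

lemma Q_lie_evalVec_emb {z y : ℂ} (h : z ≠ y) (a b : Sl n ℂ) (c : PolySl n) :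
    Q n ⁅evalVec z a, evalVec y b⁆ (emb n c)
      = z * y / (z - y) * (K ⁅a, b⁆ (evalAt n z c) - K ⁅a, b⁆ (evalAt n y c)) := by
  rw [evalVec_lie h, map_smul, map_sub, LinearMap.smul_apply, LinearMap.sub_apply, Q_evalVec_emb,
    Q_evalVec_emb, smul_eq_mul]

lemma Q_evalVec_lie_emb (z : ℂ) (a : Sl n ℂ) (c d : PolySl n) :
    Q n ⁅evalVec z a, emb n c⁆ (emb n d) = K a ⁅evalAt n z c, evalAt n z d⁆ := by
  rw [Q_lie_left, ← emb_lie, Q_evalVec_emb, evalAt_lie]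

lemma Q_lie_evalVec_evalVec {z y : ℂ} (h : z ≠ y) (a b : Sl n ℂ) {w : Double n}
    (hw : w ∈ dualP n) : Q n ⁅evalVec z a, evalVec y b⁆ w = 0 := by
  refine Q_dualP ?_ hw
  rw [evalVec_lie h]
  exact Submodule.smul_mem _ _ (sub_mem (evalVec_mem_dualP _ _) (evalVec_mem_dualP _ _))

/-- The left hand side of the classical Yang-Baxter equation is the obstruction to the graph being
closed under the bracket. -/
lemma tri_cybe (hn : n ≠ 0) {p : PolySl n ⊗[ℂ] PolySl n}
    (hp : TensorProduct.comm ℂ (PolySl n) (PolySl n) p = -p) {z₁ z₂ z₃ : ℂ} (h₁₂ : z₁ ≠ z₂)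
    (h₁₃ : z₁ ≠ z₃) (h₂₃ : z₂ ≠ z₃) (a₁ a₂ a₃ : Sl n ℂ) :
    tri a₁ a₂ a₃ (br₁₂₁₃ (rFun p z₁ z₂) (rFun p z₁ z₃) + br₁₂₂₃ (rFun p z₁ z₂) (rFun p z₂ z₃)
        + br₁₃₂₃ (rFun p z₁ z₃) (rFun p z₂ z₃))
      = Q n ⁅evalVec z₁ a₁ + emb n (contract p (evalVec z₁ a₁)),
          evalVec z₂ a₂ + emb n (contract p (evalVec z₂ a₂))⁆
        (evalVec z₃ a₃ + emb n (contract p (evalVec z₃ a₃))) := by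
  rw [map_add, map_add, tri_br₁₂₁₃, tri_br₁₂₂₃, tri_br₁₃₂₃]
  simp only [leftC_rFun hn, rightC_rFun hn hp]
  generalize contract p (evalVec z₁ a₁) = c₁
  generalize contract p (evalVec z₂ a₂) = c₂
  generalize contract p (evalVec z₃ a₃) = c₃
  -- All eight terms, rotated cyclically so that evaluation vectors come first. The two unmixed ones
  -- vanish, because `P*` and `i(P)` are isotropic and the brackets involved stay inside them.
  have e1 : Q n ⁅evalVec z₁ a₁ + emb n c₁, evalVec z₂ a₂ + emb n c₂⁆ (evalVec z₃ a₃ + emb n c₃)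
      = Q n ⁅evalVec z₁ a₁, evalVec z₂ a₂⁆ (evalVec z₃ a₃)
        + Q n ⁅evalVec z₁ a₁, evalVec z₂ a₂⁆ (emb n c₃)
        + Q n ⁅evalVec z₃ a₃, evalVec z₁ a₁⁆ (emb n c₂)
        + Q n ⁅evalVec z₂ a₂, evalVec z₃ a₃⁆ (emb n c₁)
        + Q n ⁅evalVec z₁ a₁, emb n c₂⁆ (emb n c₃)
        + Q n ⁅evalVec z₂ a₂, emb n c₃⁆ (emb n c₁)
        + Q n ⁅evalVec z₃ a₃, emb n c₁⁆ (emb n c₂)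
        + Q n (emb n ⁅c₁, c₂⁆) (emb n c₃) := by
    have f1 := Q_lie_rotate (evalVec z₁ a₁) (emb n c₂) (evalVec z₃ a₃)
    have f2 := Q_lie_rotate (evalVec z₂ a₂) (evalVec z₃ a₃) (emb n c₁)
    have f3 := Q_lie_rotate (evalVec z₂ a₂) (emb n c₃) (emb n c₁)
    have f4 := Q_lie_rotate (emb n c₁) (emb n c₂) (evalVec z₃ a₃)
    rw [add_lie, lie_add, lie_add, emb_lie]
    simp only [map_add, LinearMap.add_apply]
    linear_combination f1 - f2 - f3 + f4
  rw [e1, Q_emb_emb, Q_lie_evalVec_evalVec h₁₂ _ _ (evalVec_mem_dualP _ _),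
    Q_lie_evalVec_emb h₁₂, Q_lie_evalVec_emb h₁₃.symm, Q_lie_evalVec_emb h₂₃, Q_evalVec_lie_emb,
    Q_evalVec_lie_emb, Q_evalVec_lie_emb]
  simp only [sub_eq_add_neg (_ • _ : Sl n ℂ), K_smul_add_lie_smul_add, neg_lie, lie_neg,
    K_neg_right, neg_neg]
  have d₁₂ : z₂ - z₁ ≠ 0 := sub_ne_zero.2 h₁₂.symm
  have d₁₃ : z₃ - z₁ ≠ 0 := sub_ne_zero.2 h₁₃.symm
  have d₂₃ : z₃ - z₂ ≠ 0 := sub_ne_zero.2 h₂₃.symm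
  have g₁₂ : z₁ * z₂ / (z₁ - z₂) = -(z₁ * z₂ / (z₂ - z₁)) := by
    rw [← neg_sub z₂ z₁, div_neg]
  have g₃₁ : z₃ * z₁ / (z₃ - z₁) = z₁ * z₃ / (z₃ - z₁) := by rw [mul_comm]
  have g₂₃ : z₂ * z₃ / (z₂ - z₃) = -(z₂ * z₃ / (z₃ - z₂)) := by
    rw [← neg_sub z₃ z₂, div_neg]
  -- The scalar identity behind `u v Ω / (v - u)` being a solution itself; the reciprocals are
  -- differences of the `1 / zᵢ`.
  have hyb : z₁ * z₂ / (z₂ - z₁) * (z₁ * z₃ / (z₃ - z₁))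
      - z₁ * z₂ / (z₂ - z₁) * (z₂ * z₃ / (z₃ - z₂))
      + z₁ * z₃ / (z₃ - z₁) * (z₂ * z₃ / (z₃ - z₂)) = 0 := by
    field_simp
    ring
  have i₁ : K a₂ ⁅a₁, a₃⁆ = -K a₁ ⁅a₂, a₃⁆ := by
    rw [K_lie_rotate, K_lie_swap_left, K_comm]
  have i₂ : K a₃ ⁅a₁, a₂⁆ = K a₁ ⁅a₂, a₃⁆ := by
    rw [K_lie_rotate, K_comm]
  rw [g₁₂, g₃₁, g₂₃, K_lie_swap_left a₂ a₁, K_lie_swap_left a₃ a₂,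
    K_lie_swap_right a₂ _ (evalAt n z₂ c₁), i₁, i₂]
  linear_combination K a₁ ⁅a₂, a₃⁆ * hyb

/-- Maximal isotropy turns closure into the vanishing of `Q([x, y], z)` on the graph. This is known
for lifted evaluation vectors at distinct points, and invariance replaces them one at a time by
arbitrary elements. -/
lemma lie_mem_graph (hn : n ≠ 0) {p : PolySl n ⊗[ℂ] PolySl n}
    (hp : TensorProduct.comm ℂ (PolySl n) (PolySl n) p = -p) (h : CYBE (rFun p)) {x y : Double n}
    (hx : x ∈ graph p) (hy : y ∈ graph p) : ⁅x, y⁆ ∈ graph p := by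
  have hW : ∀ z a, evalVec z a + emb n (contract p (evalVec z a)) ∈ graph p := fun z a =>
    mem_graph.2 ⟨_, evalVec_mem_dualP z a, rfl⟩
  have rot : ∀ x y z : Double n, Q n x ⁅y, z⁆ = Q n z ⁅x, y⁆ := fun x y z => by
    rw [← Q_lie_left, Q_comm]
  generalize hV : (fun (z : ℂ) (a : Sl n ℂ) => evalVec z a + emb n (contract p (evalVec z a))) = V
  have hW' : ∀ z a, V z a ∈ graph p := fun z a => by rw [← hV]; exact hW z a
  have hmem : ∀ (s : Finset ℂ) {x : Double n}, (∀ z ∉ s, ∀ a, Q n (V z a) x = 0) → x ∈ graph p := by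
    intro s x hx
    refine mem_graph_of_evalVec hn hp s fun z hz a => ?_
    rw [← hx z hz a, ← hV]
  have h1 : ∀ z₁ a₁ z₂ a₂, z₁ ≠ z₂ → ⁅V z₁ a₁, V z₂ a₂⁆ ∈ graph p := by
    intro z₁ a₁ z₂ a₂ h₁₂
    refine hmem {z₁, z₂} fun z₃ hz₃ a₃ => ?_
    rw [Finset.mem_insert, Finset.mem_singleton, not_or] at hz₃
    have h0 := tri_cybe hn hp h₁₂ (Ne.symm hz₃.1) (Ne.symm hz₃.2) a₁ a₂ a₃
    rw [h z₁ z₂ z₃ h₁₂ (Ne.symm hz₃.1) (Ne.symm hz₃.2), map_zero] at h0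
    rw [Q_comm, ← hV]
    exact h0.symm
  -- Testing only at points other than `z` avoids the bracket of two lifts at the same point.
  have h2 : ∀ y ∈ graph p, ∀ z a, ⁅y, V z a⁆ ∈ graph p := by
    intro y hy z a
    refine hmem {z} fun z' hz' a' => ?_
    rw [rot, rot]
    exact Q_graph hp hy (h1 z a z' a' (Ne.symm (by simpa using hz')))
  refine hmem ∅ fun z _ a => ?_
  rw [rot]
  have := h2 x hx z a
  rw [← lie_skew, map_neg, neg_eq_zero]
  exact Q_graph hp hy this

lemma cybe_of_lie_mem (hn : n ≠ 0) {p : PolySl n ⊗[ℂ] PolySl n}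
    (hp : TensorProduct.comm ℂ (PolySl n) (PolySl n) p = -p)
    (h : ∀ x ∈ graph p, ∀ y ∈ graph p, ⁅x, y⁆ ∈ graph p) : CYBE (rFun p) := by
  have hW : ∀ z a, evalVec z a + emb n (contract p (evalVec z a)) ∈ graph p := fun z a =>
    mem_graph.2 ⟨_, evalVec_mem_dualP z a, rfl⟩
  intro z₁ z₂ z₃ h₁₂ h₁₃ h₂₃
  refine eq_zero_of_tri hn _ fun a₁ a₂ a₃ => ?_
  rw [tri_cybe hn hp h₁₂ h₁₃ h₂₃]
  exact Q_graph hp (h _ (hW _ _) _ (hW _ _)) (hW _ _)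

end YangBaxter

/-! ### The polynomial part is determined by the graph -/

section Injectivity

variable {n : ℕ}

/-- The functionals on `P` given by elements of `P*` separate points, so they detect the first
tensor factor. -/
lemma eq_of_contract_eq (hn : n ≠ 0) {p p' : PolySl n ⊗[ℂ] PolySl n}
    (h : ∀ w ∈ dualP n, contract p w = contract p' w) : p = p' := by
  rw [← sub_eq_zero]
  have hs : ∀ w ∈ dualP n, contract (p - p') w = 0 := fun w hw => by
    rw [sub_eq_add_neg, contract_add, contract_neg, h w hw, add_neg_cancel]
  generalize p - p' = t at hs
  refine tensor_eq_zero_of_left (fun w : dualP n => Q n w.1 ∘ₗ emb n) (fun c hc => ?_) t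
    fun w => ?_
  · exact eq_zero_of_Q_evalVec hn ∅ c fun z _ a => hc ⟨_, evalVec_mem_dualP z a⟩
  · refine (TensorProduct.lid ℂ (PolySl n)).injective ?_
    rw [map_zero]
    exact hs w.1 w.2

end Injectivity

/-! ### Lagrangian subalgebras of `sl(n, ℂ[ε])` and pairs `(L, B)` -/

section Cocycle

open LieModule.Cohomology

variable {L : Type} [LieRing L] [LieAlgebra ℂ L]

/-- A scalar 2-cocycle from an alternating bilinear form. -/
def cocycleOfForm (β : L →ₗ[ℂ] L →ₗ[ℂ] ℂ) (halt : ∀ x, β x x = 0)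
    (hcoc : ∀ x y z, β x ⁅y, z⁆ = β ⁅x, y⁆ z + β y ⁅x, z⁆) :
    twoCocycle ℂ L (TrivialLieModule ℂ L ℂ) :=
  ⟨⟨β.compr₂ (TrivialLieModule.equiv ℂ L ℂ).symm.toLinearMap, fun x => by
      rw [LinearMap.compr₂_apply, halt, map_zero]⟩,
    (mem_twoCocycle_iff_of_trivial ℂ L _ _).2 fun x y z => by
      change (TrivialLieModule.equiv ℂ L ℂ).symm (β x ⁅y, z⁆)
        = (TrivialLieModule.equiv ℂ L ℂ).symm (β ⁅x, y⁆ z)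
          + (TrivialLieModule.equiv ℂ L ℂ).symm (β y ⁅x, z⁆)
      rw [← map_add, hcoc]⟩

end Cocycle

/-! ### From a pair to a transversal Lagrangian subalgebra -/

namespace Pair

variable {n k : ℕ} (c : Pair n k)

/-- The 2-cocycle of a pair as a bilinear form. -/
def bilin : c.L →ₗ[ℂ] c.L →ₗ[ℂ] ℂ :=
  c.B.1.1.compr₂ (TrivialLieModule.equiv ℂ c.L ℂ).toLinearMap

lemma bilin_self (x : c.L) : c.bilin x x = 0 := by
  have h : c.B.1.1 x x = 0 := c.B.1.2 x
  change TrivialLieModule.equiv ℂ c.L ℂ (c.B.1.1 x x) = 0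
  rw [h, map_zero]

lemma bilin_skew (x y : c.L) : c.bilin x y = -c.bilin y x := by
  have h := c.bilin_self (x + y)
  simp only [map_add, LinearMap.add_apply, bilin_self] at h
  linear_combination h

lemma bilin_lie (x y z : c.L) : c.bilin x ⁅y, z⁆ = c.bilin ⁅x, y⁆ z + c.bilin y ⁅x, z⁆ := by
  have h := (LieModule.Cohomology.mem_twoCocycle_iff_of_trivial ℂ c.L _ _).1 c.B.2 x y z
  change TrivialLieModule.equiv ℂ c.L ℂ (c.B.1 x ⁅y, z⁆) = _
  rw [h, map_add]
  rfl

lemma mem_lagr {A : Sl n (DualNumber ℂ)} :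
    A ∈ c.lagr ↔ ∃ h : part₀ n A ∈ c.L, ∀ y : c.L,
      K (part₁ n A) y.1 = c.bilin ⟨part₀ n A, h⟩ y := Iff.rfl

/-- `lagr` as a subspace. -/
def lagrSubmodule : Submodule ℂ (Sl n (DualNumber ℂ)) where
  carrier := c.lagr
  add_mem' {A A'} hA hA' := by
    obtain ⟨h, hA⟩ := c.mem_lagr.1 hA
    obtain ⟨h', hA'⟩ := c.mem_lagr.1 hA'
    refine c.mem_lagr.2 ⟨by rw [map_add]; exact add_mem h h', fun y => ?_⟩
    rw [map_add, K_add_left, hA, hA', ← LinearMap.add_apply, ← map_add]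
    rfl
  zero_mem' := by
    refine c.mem_lagr.2 ⟨by rw [map_zero]; exact zero_mem _, fun y => ?_⟩
    have h0 : (⟨part₀ n 0, by rw [map_zero]; exact zero_mem _⟩ : c.L) = 0 :=
      Subtype.ext (map_zero _)
    rw [h0, map_zero, map_zero, K_zero_left]
    rfl
  smul_mem' t A hA := by
    obtain ⟨h, hA⟩ := c.mem_lagr.1 hA
    refine c.mem_lagr.2 ⟨by rw [map_smul]; exact c.L.toSubmodule.smul_mem t h, fun y => ?_⟩
    rw [map_smul, K_smul_left, hA, ← LinearMap.smul_apply, ← map_smul]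
    rfl

lemma lagr_isotropic {A A' : Sl n (DualNumber ℂ)} (hA : A ∈ c.lagr) (hA' : A' ∈ c.lagr) :
    K (part₀ n A) (part₁ n A') + K (part₁ n A) (part₀ n A') = 0 := by
  obtain ⟨h, hA⟩ := c.mem_lagr.1 hA
  obtain ⟨h', hA'⟩ := c.mem_lagr.1 hA'
  rw [K_comm, hA' ⟨_, h⟩, hA ⟨_, h'⟩, c.bilin_skew]
  ring

/-- For `x + a ε` and `x' + a' ε`, invariance pairs the `ε`-part of the bracket with `y` to `B(x,
[x', y]) - B(x', [x, y])`, which is `B([x, x'], y)` by the cocycle identity. -/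
lemma lie_mem_lagr {A A' : Sl n (DualNumber ℂ)} (hA : A ∈ c.lagr) (hA' : A' ∈ c.lagr) :
    ⁅A, A'⁆ ∈ c.lagr := by
  obtain ⟨h, hA⟩ := c.mem_lagr.1 hA
  obtain ⟨h', hA'⟩ := c.mem_lagr.1 hA'
  refine c.mem_lagr.2 ⟨by rw [part₀_lie]; exact c.L.lie_mem h h', fun y => ?_⟩
  have e : (⟨part₀ n ⁅A, A'⁆, by rw [part₀_lie]; exact c.L.lie_mem h h'⟩ : c.L)
      = ⁅(⟨part₀ n A, h⟩ : c.L), (⟨part₀ n A', h'⟩ : c.L)⁆ := Subtype.ext (part₀_lie A A')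
  have h1 := hA ⁅(⟨part₀ n A', h'⟩ : c.L), y⁆
  have h2 := hA' ⁅(⟨part₀ n A, h⟩ : c.L), y⁆
  have h3 := c.bilin_lie ⟨part₀ n A, h⟩ ⟨part₀ n A', h'⟩ y
  rw [LieSubalgebra.coe_bracket] at h1 h2
  rw [e, part₁_lie, K_add_left, K_lie_left (part₁ n A), K_lie_swap_left, K_lie_left, h1, h2]
  linear_combination h3

/-- Every functional on `L` extends to `sl(n)` and is represented by `K`. Hence the projection of
`lagr` is all of `L`. -/
lemma exists_dual_mem_lagr (hn : n ≠ 0) (x : c.L) : ∃ a, dual x.1 a ∈ c.lagr := by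
  obtain ⟨a, ha, -⟩ := exists_K_eq_on hn c.L.toSubmodule ⊥ (c.bilin x) fun y hy => by
    have : y = 0 := Subtype.ext ((Submodule.mem_bot ℂ).1 hy)
    rw [this, map_zero]
  refine ⟨a, c.mem_lagr.2 ⟨by rw [part₀_dual]; exact x.2, fun y => ?_⟩⟩
  rw [part₁_dual, ha]
  congr 2
  exact Subtype.ext (part₀_dual _ _).symm

lemma lagr_injective (hn : n ≠ 0) {c c' : Pair n k} (h : c.lagr = c'.lagr) : c = c' := by
  have hle : ∀ {c c' : Pair n k}, c.lagr = c'.lagr → ∀ x ∈ c.L, x ∈ c'.L := by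
    intro c c' h x hx
    obtain ⟨a, ha⟩ := c.exists_dual_mem_lagr hn ⟨x, hx⟩
    rw [h] at ha
    obtain ⟨h', -⟩ := c'.mem_lagr.1 ha
    rwa [part₀_dual] at h'
  have hL : c.L = c'.L := LieSubalgebra.ext _ _ fun x => ⟨hle h x, hle h.symm x⟩
  have hB : ∀ (x y : Sl n ℂ) (hx : x ∈ c.L) (hy : y ∈ c.L) (hx' : x ∈ c'.L) (hy' : y ∈ c'.L),
      c.bilin ⟨x, hx⟩ ⟨y, hy⟩ = c'.bilin ⟨x, hx'⟩ ⟨y, hy'⟩ := by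
    intro x y hx hy hx' hy'
    obtain ⟨a, ha⟩ := c.exists_dual_mem_lagr hn ⟨x, hx⟩
    have ha' := ha
    rw [h] at ha'
    obtain ⟨h1, ha⟩ := c.mem_lagr.1 ha
    obtain ⟨h1', ha'⟩ := c'.mem_lagr.1 ha'
    have e := (ha ⟨y, hy⟩).symm.trans (ha' ⟨y, hy'⟩)
    simpa only [part₀_dual] using e
  obtain ⟨L, B, _, _⟩ := c
  obtain ⟨L', B', _, _⟩ := c'
  obtain rfl : L = L' := hL
  have : B = B' := by
    refine Subtype.ext (Subtype.ext (LinearMap.ext fun x => LinearMap.ext fun y => ?_))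
    exact hB x.1 y.1 x.2 y.2 x.2 y.2
  subst this
  rfl

/-- For `x + a ε` in the intersection, `B(x, ·) = K(a, ·)` vanishes on `L ∩ P_k`, so `x = 0`. Then
`a` is orthogonal to `L` and to `P_k`, hence to `sl(n)`. -/
lemma eq_zero_of_mem_lagr (hn : n ≠ 0) {A : Sl n (DualNumber ℂ)} (hA : A ∈ c.lagr)
    (h0 : part₀ n A ∈ parabolic n k)
    (h1 : ∀ i j : Fin n, ¬ (i.val < k ∧ k ≤ j.val) → (part₁ n A).1 i j = 0) : A = 0 := by
  obtain ⟨h, hA⟩ := c.mem_lagr.1 hA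
  have e0 : (⟨part₀ n A, h⟩ : c.L) = 0 := by
    refine c.nondeg _ h0 fun y hy => ?_
    refine (TrivialLieModule.equiv ℂ c.L ℂ).injective ?_
    rw [map_zero]
    exact (hA y).symm.trans (K_eq_zero_of_parabolic h1 hy)
  refine dual_ext ?_ ?_
  · rw [map_zero]
    exact congrArg Subtype.val e0
  · rw [map_zero]
    refine K_nondegenerate hn _ fun b => ?_
    have hb : b ∈ c.L.toSubmodule ⊔ parabolic n k := by rw [c.add_eq]; trivial
    obtain ⟨y, hy, z, hz, rfl⟩ := Submodule.mem_sup.1 hb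
    rw [K_add_right, K_eq_zero_of_parabolic h1 hz, hA ⟨y, hy⟩, e0, map_zero, add_zero]
    rfl

/-- `sl(n, ℂ[ε])` is the sum of `lagr` and `P_k ⊕ P_k^⊥ ε`. -/
lemma exists_sub_dual_mem_lagr (hn : n ≠ 0) (A : Sl n (DualNumber ℂ)) :
    ∃ x ∈ parabolic n k, ∃ b : Sl n ℂ,
      (∀ i j : Fin n, ¬ (i.val < k ∧ k ≤ j.val) → b.1 i j = 0) ∧ A - dual x b ∈ c.lagr := by
  have hA : part₀ n A ∈ c.L.toSubmodule ⊔ parabolic n k := by rw [c.add_eq]; trivial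
  obtain ⟨l, hl, x, hx, hlx⟩ := Submodule.mem_sup.1 hA
  -- The splitting `A₀ = l + x` can be changed by any `m ∈ L ∩ P_k`. Nondegeneracy in finite
  -- dimension yields `m` for which the defect `K(A₁, ·) - B(l + m, ·)` vanishes on `L ∩ P_k`; it is
  -- then represented by some `b ∈ P_k^⊥`.
  let M : Submodule ℂ c.L := (parabolic n k).comap c.L.toSubmodule.subtype
  let φ : c.L →ₗ[ℂ] ℂ := KForm n (part₁ n A) ∘ₗ c.L.toSubmodule.subtype - c.bilin ⟨l, hl⟩
  let β : M →ₗ[ℂ] Module.Dual ℂ M := c.bilin.compl₁₂ M.subtype M.subtype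
  have hinj : Function.Injective β := by
    refine (injective_iff_map_eq_zero β).2 fun m hm => ?_
    refine Subtype.ext (c.nondeg m.1 m.2 fun y hy => ?_)
    refine (TrivialLieModule.equiv ℂ c.L ℂ).injective ?_
    rw [map_zero]
    exact LinearMap.congr_fun hm ⟨y, hy⟩
  have hsurj : Function.Surjective β :=
    (LinearMap.injective_iff_surjective_of_finrank_eq_finrank
      (Subspace.dual_finrank_eq (K := ℂ) (V := M)).symm).1 hinj
  obtain ⟨m, hm⟩ := hsurj (φ ∘ₗ M.subtype)
  obtain ⟨b, hb, hbP⟩ := exists_K_eq_on hn c.L.toSubmodule (parabolic n k) (φ - c.bilin m.1)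
    fun y hy => by
      have : c.bilin m.1 y = φ y := LinearMap.congr_fun hm ⟨y, hy⟩
      rw [LinearMap.sub_apply, this, sub_self]
  have hm0 : part₀ n (A - dual (x - m.1.1) b) = l + m.1.1 := by
    rw [map_sub, part₀_dual, ← hlx]
    abel
  refine ⟨x - m.1.1, sub_mem hx m.2, b, eq_zero_of_K_parabolic hn hbP,
    c.mem_lagr.2 ⟨?_, fun y => ?_⟩⟩
  · rw [hm0]
    exact add_mem hl m.1.2
  · have e : (⟨part₀ n (A - dual (x - m.1.1) b), by rw [hm0]; exact add_mem hl m.1.2⟩ : c.L)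
        = ⟨l, hl⟩ + m.1 := Subtype.ext hm0
    have hby : K b y.1 = K (part₁ n A) y.1 - c.bilin ⟨l, hl⟩ y - c.bilin m.1 y := hb y
    rw [e, map_sub, part₁_dual, K_sub_left, hby, map_add, LinearMap.add_apply]
    ring

end Pair

/-- A Lagrangian subalgebra of `sl(n, ℂ[ε])` that is transversal to `P_k ⊕ P_k^⊥ ε` comes from a
pair. -/
lemma exists_lagr_eq {n k : ℕ} (hn : n ≠ 0) (V : Submodule ℂ (Sl n (DualNumber ℂ)))
    (hlie : ∀ A ∈ V, ∀ A' ∈ V, ⁅A, A'⁆ ∈ V)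
    (hiso : ∀ A ∈ V, ∀ A' ∈ V, K (part₀ n A) (part₁ n A') + K (part₁ n A) (part₀ n A') = 0)
    (hmax : ∀ A, (∀ A' ∈ V, K (part₀ n A') (part₁ n A) + K (part₁ n A') (part₀ n A) = 0) → A ∈ V)
    (htrans : ∀ x a : Sl n ℂ, x ∈ parabolic n k →
      (∀ i j : Fin n, ¬ (i.val < k ∧ k ≤ j.val) → a.1 i j = 0) → dual x a ∈ V → x = 0 ∧ a = 0) :
    ∃ c : Pair n k, c.lagr = (V : Set (Sl n (DualNumber ℂ))) := by
  let L : LieSubalgebra ℂ (Sl n ℂ) :=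
    { V.map (part₀ n) with
      lie_mem' := by
        rintro _ _ ⟨A, hA, rfl⟩ ⟨A', hA', rfl⟩
        exact ⟨⁅A, A'⁆, hlie A hA A' hA', part₀_lie A A'⟩ }
  have hL : ∀ x : L, ∃ A ∈ V, part₀ n A = x.1 := fun x => x.2
  -- The lifts are not chosen linearly; isotropy shows that the form does not depend on them and
  -- that it is linear in its first argument.
  choose lift hliftV hlift using hL
  have hskew : ∀ x : L, ∀ A ∈ V, K (part₁ n (lift x)) (part₀ n A) = -K x.1 (part₁ n A) := by
    intro x A hA
    have := hiso (lift x) (hliftV x) A hA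
    rw [hlift] at this
    linear_combination this
  have hval : ∀ A (hA : A ∈ V) (y : L),
      K (part₁ n A) y.1 = K (part₁ n (lift ⟨part₀ n A, A, hA, rfl⟩)) y.1 := by
    intro A hA y
    have h1 := hskew ⟨part₀ n A, A, hA, rfl⟩ (lift y) (hliftV y)
    have h2 := hiso A hA (lift y) (hliftV y)
    rw [hlift] at h1 h2
    linear_combination h2 - h1
  have hβ : ∀ x y : L, K (part₁ n (lift x)) y.1 = -K x.1 (part₁ n (lift y)) := by
    intro x y
    have := hskew x (lift y) (hliftV y)
    rwa [hlift] at this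
  let β : L →ₗ[ℂ] L →ₗ[ℂ] ℂ := LinearMap.mk₂ ℂ (fun x y => K (part₁ n (lift x)) y.1)
    (fun x x' y => by
      rw [hβ, hβ, hβ, ← neg_add]
      exact congrArg Neg.neg (K_add_left _ _ _))
    (fun t x y => by
      rw [hβ, hβ, smul_neg]
      exact congrArg Neg.neg (K_smul_left _ _ _))
    (fun x y y' => K_add_right _ _ _)
    (fun t x y => K_smul_right _ _ _)
  have hβ_val : ∀ A (hA : A ∈ V) (y : L), K (part₁ n A) y.1 = β ⟨part₀ n A, A, hA, rfl⟩ y := hval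
  have hβ_apply : ∀ x y : L, β x y = K (part₁ n (lift x)) y.1 := fun _ _ => rfl
  have halt : ∀ x, β x x = 0 := by
    intro x
    have h := hβ x x
    rw [K_comm x.1] at h
    rw [hβ_apply]
    linear_combination (1 / 2 : ℂ) * h
  have hcoc : ∀ x y z, β x ⁅y, z⁆ = β ⁅x, y⁆ z + β y ⁅x, z⁆ := by
    intro x y z
    have h := hβ_val ⁅lift x, lift y⁆ (hlie _ (hliftV x) _ (hliftV y)) z
    have e : (⟨part₀ n ⁅lift x, lift y⁆, _, hlie _ (hliftV x) _ (hliftV y), rfl⟩ : L) = ⁅x, y⁆ := by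
      refine Subtype.ext ?_
      change part₀ n ⁅lift x, lift y⁆ = ⁅x.1, y.1⁆
      rw [part₀_lie, hlift, hlift]
    rw [e, part₁_lie, hlift, hlift, K_add_left, K_lie_swap_left, K_lie_left, K_lie_left] at h
    rw [hβ_apply x, hβ_apply y, ← h, LieSubalgebra.coe_bracket, LieSubalgebra.coe_bracket]
    ring
  let B := cocycleOfForm β halt hcoc
  have hadd : L.toSubmodule ⊔ parabolic n k = ⊤ := by
    -- A proper sum has a nonzero `a` orthogonal to `L` and `P_k`; then `a ε` is orthogonal to `V`,
    -- so it lies in `V`, against transversality.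
    by_contra hne
    obtain ⟨f, hf, hle⟩ := Submodule.exists_le_ker_of_lt_top _ (lt_top_iff_ne_top.2 hne)
    obtain ⟨a, ha⟩ := exists_K_eq hn f
    have haL : ∀ y ∈ L, K a y = 0 := fun y hy => by
      rw [ha]; exact hle (Submodule.mem_sup_left hy)
    have haP : ∀ y ∈ parabolic n k, K a y = 0 := fun y hy => by
      rw [ha]; exact hle (Submodule.mem_sup_right hy)
    have hmem : dual 0 a ∈ V := hmax _ fun A' hA' => by
      rw [part₀_dual, part₁_dual, K_zero_right, K_comm, haL _ ⟨A', hA', rfl⟩, add_zero]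
    have h0 := (htrans 0 a (zero_mem _) (eq_zero_of_K_parabolic hn haP) hmem).2
    refine hf (LinearMap.ext fun y => ?_)
    rw [← ha, h0, K_zero_left]
    rfl
  have hnondeg : ∀ x : L, x.1 ∈ parabolic n k →
      (∀ y : L, y.1 ∈ parabolic n k → B.1 x y = 0) → x = 0 := by
    intro x hx hB
    -- Degeneracy lets `β x` be represented by `a ∈ P_k^⊥`; maximality puts `x + a ε` in `V`, and
    -- transversality kills it.
    obtain ⟨a, ha, haP⟩ := exists_K_eq_on hn L.toSubmodule (parabolic n k) (β x) fun y hy => hB y hy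
    have hmem : dual x.1 a ∈ V := hmax _ fun A' hA' => by
      have h1 := ha ⟨part₀ n A', A', hA', rfl⟩
      have h2 := hskew x A' hA'
      rw [part₀_dual, part₁_dual, K_comm _ a, K_comm _ x.1, h1]
      exact add_eq_zero_iff_eq_neg.2 h2
    exact Subtype.ext (htrans x.1 a hx (eq_zero_of_K_parabolic hn haP) hmem).1
  refine ⟨⟨L, B, hadd, hnondeg⟩, Set.ext fun A => ⟨fun hA => ?_, fun hA => ?_⟩⟩
  · obtain ⟨h, hA⟩ := hA
    refine hmax A fun A' hA' => ?_
    have h1 : K (part₁ n A) (part₀ n A') = β ⟨part₀ n A, h⟩ ⟨part₀ n A', A', hA', rfl⟩ :=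
      hA ⟨part₀ n A', A', hA', rfl⟩
    have h2 := hskew ⟨part₀ n A, h⟩ A' hA'
    rw [hβ_apply] at h1
    rw [K_comm _ (part₁ n A), K_comm _ (part₀ n A), h1, h2]
    ring
  · exact ⟨⟨A, hA, rfl⟩, hβ_val A hA⟩

/-! ### Complements of `i(P)` as graphs -/

section Complement

variable {n : ℕ}

/-- The constant coefficient of an element of `sl(n)((u⁻¹))`. -/
def constCoef : Sl n Laurent →ₗ[ℂ] Sl n ℂ :=
  slMap n
    { toFun := fun f => f.coeff 0
      map_add' := fun _ _ => rfl
      map_smul' := fun _ _ => rfl }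

lemma constCoef_apply (f : Sl n Laurent) (i j : Fin n) :
    (constCoef f).1 i j = (f.1 i j).coeff 0 := rfl

lemma emb_tens_X_snd (a : Sl n ℂ) :
    part₀ n (emb n (tens Polynomial.X a)).2 = 0 ∧ part₁ n (emb n (tens Polynomial.X a)).2 = a := by
  have h := coef_tens (n := n)
  rw [part₀_emb, part₁_emb, ← pow_one (Polynomial.X : Polynomial ℂ), h, h]
  simp

lemma emb_tens_one_snd (a : Sl n ℂ) :
    part₀ n (emb n (tens 1 a)).2 = a ∧ part₁ n (emb n (tens 1 a)).2 = 0 := by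
  have h := coef_tens (n := n)
  rw [part₀_emb, part₁_emb, ← pow_zero (Polynomial.X : Polynomial ℂ), h, h]
  simp

/-- On `P*`, pairing with `a u` reads the constant term of the series, and pairing with constants
reads the `ε`-coefficient with a sign: the coordinates of `P*` modulo `u⁻¹ sl(n)[[u⁻¹]]`. -/
lemma Q_dualP_emb_tens_X {w : Double n} (hw : w ∈ dualP n) (a : Sl n ℂ) :
    Q n w (emb n (tens Polynomial.X a)) = K (constCoef w.1) a := by
  rw [mem_dualP] at hw
  rw [Q_apply, (emb_tens_X_snd a).1, hw.2, K_zero_left, K_zero_right, sub_zero, sub_zero, coeff_K,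
    K_eq_trace, Matrix.trace]
  congr 1
  refine Finset.sum_congr rfl fun i _ => ?_
  rw [Matrix.diag_apply, Matrix.mul_apply]
  refine Finset.sum_congr rfl fun j _ => ?_
  have h : ofPoly Polynomial.X = uPow 1 := Polynomial.aeval_X _
  rw [emb_fst_apply, tens_apply, map_smul, h, mul_smul_comm, HahnSeries.coeff_smul, mul_comm,
    coeff_uPow_mul, constCoef_apply, smul_eq_mul, mul_comm]
  rfl

lemma Q_dualP_emb_tens_one {w : Double n} (hw : w ∈ dualP n) (a : Sl n ℂ) :
    Q n w (emb n (tens 1 a)) = K (-part₁ n w.2) a := by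
  rw [mem_dualP] at hw
  have h : (emb n (tens 1 a)).1 ∈ lattice fun _ : Fin n => (0 : ℤ) := by
    intro i j m hm
    have hm' : m < 0 := by simpa using hm
    rw [emb_fst_apply, tens_apply, map_smul, map_one, HahnSeries.coeff_smul, HahnSeries.coeff_one,
      if_neg hm'.ne, smul_zero]
  rw [Q_apply, (emb_tens_one_snd a).1, hw.2, K_zero_left, sub_zero, K_neg_left,
    coeff_K_lattice hw.1 h, zero_sub]

/-- With `t = Ω` the value is `S y`, which allows a tensor to be built with a prescribed
contraction. -/
lemma contract_map {w : Double n} {y : Sl n ℂ} (α S : Sl n ℂ →ₗ[ℂ] PolySl n)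
    (h : ∀ a, Q n w (emb n (α a)) = K y a) (t : Sl n ℂ ⊗[ℂ] Sl n ℂ) :
    contract (TensorProduct.map α S t) w = S (leftC y t) := by
  induction t using TensorProduct.induction_on with
  | zero => simp only [map_zero, contract_zero]
  | add t t' ht ht' => simp only [map_add, contract_add, ht, ht']
  | tmul a b => rw [TensorProduct.map_tmul, contract_tmul, leftC_tmul, map_smul, h]

/-- A Lagrangian complement of `i(P)` that contains `u⁻¹ sl(n)[[u⁻¹]]` is the graph of a
skew-symmetric tensor. -/
lemma exists_graph_eq (hn : n ≠ 0) (W : Submodule ℂ (Double n))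
    (hiso : ∀ x ∈ W, ∀ y ∈ W, Q n x y = 0) (hex : ∀ x, ∃ c, x - emb n c ∈ W)
    (huniq : ∀ c, emb n c ∈ W → c = 0)
    (hsmall : ∀ f : Sl n Laurent, (∀ i j, ∀ m ≤ 0, (f.1 i j).coeff m = 0) → (f, 0) ∈ W) :
    ∃ p : PolySl n ⊗[ℂ] PolySl n, TensorProduct.comm ℂ (PolySl n) (PolySl n) p = -p ∧
      graph p = W := by
  -- `τ` is the projection to `P` along `W`; uniqueness makes it linear.
  choose τ hτ using hex
  have hτ_eq : ∀ x c, x - emb n c ∈ W → τ x = c := by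
    intro x c h
    have := sub_mem h (hτ x)
    rw [sub_sub_sub_cancel_left, ← map_sub] at this
    exact sub_eq_zero.1 (huniq _ this)
  let T : Double n →ₗ[ℂ] PolySl n :=
    { toFun := τ
      map_add' := fun x y => hτ_eq _ _ (by
        rw [map_add, add_sub_add_comm]
        exact add_mem (hτ x) (hτ y))
      map_smul' := fun t x => hτ_eq _ _ (by
        rw [RingHom.id_apply, map_smul, ← smul_sub]
        exact W.smul_mem t (hτ x)) }
  have hT : ∀ x, x - emb n (T x) ∈ W := hτ
  have hT_eq : ∀ x c, x - emb n c ∈ W → T x = c := hτ_eq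
  have hT0 : ∀ x ∈ W, T x = 0 := fun x hx => hT_eq x 0 (by rwa [map_zero, sub_zero])
  -- The contraction must be `-T` on `P*`. Since `T` kills `u⁻¹ sl(n)[[u⁻¹]]`, it sees only the
  -- constant term and the `ε`-coefficient, one summand for each; the first needs no sign because
  -- its pairing already has one.
  let p : PolySl n ⊗[ℂ] PolySl n :=
    TensorProduct.map (tens 1) (T ∘ₗ LinearMap.inr ℂ _ _ ∘ₗ tens DualNumber.eps) (casimir n)
    - TensorProduct.map (tens Polynomial.X) (T ∘ₗ LinearMap.inl ℂ _ _ ∘ₗ tens 1) (casimir n)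
  have hp : ∀ w ∈ dualP n, contract p w = -T w := by
    intro w hw
    dsimp only [p]
    rw [sub_eq_add_neg, contract_add, contract_neg, contract_map _ _ (Q_dualP_emb_tens_X hw),
      contract_map _ _ (Q_dualP_emb_tens_one hw), leftC_casimir hn, leftC_casimir hn, map_neg,
      ← neg_add, neg_inj]
    change T (0, tens DualNumber.eps (part₁ n w.2)) + T (tens 1 (constCoef w.1), 0) = T w
    rw [mem_dualP] at hw
    have h2 : tens DualNumber.eps (part₁ n w.2) = w.2 :=
      dual_ext (by rw [part₀_tens_eps, hw.2]) (part₁_tens_eps _)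
    rw [h2, ← map_add, Prod.mk_add_mk, zero_add, add_zero, ← sub_eq_zero, ← map_sub]
    have h3 : (tens 1 (constCoef w.1), w.2) - w = (tens 1 (constCoef w.1) - w.1, 0) :=
      Prod.ext rfl (sub_self w.2)
    rw [h3]
    refine hT0 _ (hsmall _ fun i j m hm => ?_)
    change ((constCoef w.1).1 i j • (1 : Laurent) - w.1.1 i j).coeff m = 0
    rw [HahnSeries.coeff_sub, HahnSeries.coeff_smul, HahnSeries.coeff_one, constCoef_apply]
    split_ifs with h
    · rw [h, smul_eq_mul, mul_one, sub_self]
    · rw [hw.1 i j m (by simp only [sub_self]; omega), smul_zero, sub_zero]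
  have hpW : ∀ w ∈ dualP n, w + emb n (contract p w) ∈ W := fun w hw => by
    rw [hp w hw, map_neg, ← sub_eq_add_neg]
    exact hT w
  refine ⟨p, ?_, le_antisymm ?_ ?_⟩
  · refine eq_of_contract_eq hn fun w hw => ?_
    rw [contract_neg, ← sub_eq_zero, sub_neg_eq_add]
    -- Isotropy of `W`, applied to two lifts from `P*`, is skewness of the map.
    refine eq_zero_of_Q_evalVec hn ∅ _ fun z _ a => ?_
    have h := hiso _ (hpW w hw) _ (hpW _ (evalVec_mem_dualP z a))
    rw [Q_add_add, Q_dualP hw (evalVec_mem_dualP z a), Q_emb_emb, Q_comm (emb n _)] at h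
    rw [map_add, map_add, Q_emb_contract_comm]
    linear_combination h
  · intro x hx
    obtain ⟨w, hw, rfl⟩ := mem_graph.1 hx
    exact hpW w hw
  · intro x hx
    obtain ⟨c, hc⟩ := exists_sub_emb_mem_dualP x
    refine mem_graph.2 ⟨_, hc, ?_⟩
    have h := sub_mem hx (hpW _ hc)
    have e : x - (x - emb n c + emb n (contract p (x - emb n c)))
        = emb n (c - contract p (x - emb n c)) := by
      rw [map_sub (emb n) c, sub_add_eq_sub_sub, sub_sub_cancel]
    rw [e] at h
    rw [← sub_eq_zero.1 (huniq _ h)]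
    abel

end Complement

/-! ### Graphs contained in `W_k` -/

section Order

variable {n k : ℕ}

lemma shift_cases (k : ℕ) (i : Fin n) :
    i.val < k ∧ shift n k i = 0 ∨ k ≤ i.val ∧ shift n k i = 1 := by
  rw [shift]
  split_ifs with h
  · exact Or.inl ⟨h, rfl⟩
  · exact Or.inr ⟨not_lt.1 h, rfl⟩

/-- The entry `(i, j)` has degree at most `shift j - shift i`, which is `-1`, `0` or `1`. So `c = x
+ b u` with `x ∈ P_k` and `b ∈ P_k^⊥`. -/
lemma coef_of_emb_mem_lattice {c : PolySl n} (h : (emb n c).1 ∈ lattice (shift n k)) :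
    coef 0 c ∈ parabolic n k ∧
      (∀ i j : Fin n, ¬ (i.val < k ∧ k ≤ j.val) → (coef 1 c).1 i j = 0) ∧
      ∀ i j m, 2 ≤ m → (c.1 i j).coeff m = 0 := by
  have hc : ∀ i j (m : ℕ), -(m : ℤ) < shift n k i - shift n k j → (c.1 i j).coeff m = 0 := by
    intro i j m hm
    rw [← coeff_ofPoly_neg]
    exact h i j _ hm
  refine ⟨fun i j hi hj => hc i j 0 ?_, fun i j hij => hc i j 1 ?_, fun i j m hm => hc i j m ?_⟩ <;>
  · have h1 := shift_cases k i
    have h2 := shift_cases k j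
    push_cast
    omega

lemma emb_fst_mem_lattice {x b : Sl n ℂ} (hx : x ∈ parabolic n k)
    (hb : ∀ i j : Fin n, ¬ (i.val < k ∧ k ≤ j.val) → b.1 i j = 0) :
    (emb n (tens 1 x + tens Polynomial.X b)).1 ∈ lattice (shift n k) := by
  intro i j m hm
  rcases lt_or_ge 0 m with h | h
  · exact coeff_ofPoly_of_pos _ h
  obtain ⟨l, rfl⟩ : ∃ l : ℕ, m = -(l : ℤ) := ⟨(-m).toNat, by omega⟩
  rw [emb_fst_apply, coeff_ofPoly_neg]
  change (x.1 i j • (1 : Polynomial ℂ) + b.1 i j • Polynomial.X).coeff l = 0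
  have h1 := shift_cases k i
  have h2 := shift_cases k j
  rw [Polynomial.coeff_add, Polynomial.coeff_smul, Polynomial.coeff_smul, Polynomial.coeff_one,
    Polynomial.coeff_X]
  match l with
  | 0 => rw [hx i j (by omega) (by omega)]; simp
  | 1 => rw [hb i j (by omega)]; simp
  | l + 2 => simp

lemma emb_snd_tens (x b : Sl n ℂ) : (emb n (tens 1 x + tens Polynomial.X b)).2 = dual x b := by
  refine dual_ext ?_ ?_
  · rw [map_add, Prod.snd_add, map_add, (emb_tens_one_snd x).1, (emb_tens_X_snd b).1, part₀_dual,
      add_zero]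
  · rw [map_add, Prod.snd_add, map_add, (emb_tens_one_snd x).2, (emb_tens_X_snd b).2, part₁_dual,
      zero_add]

lemma mem_lattice_of_small (f : Sl n Laurent) (hf : ∀ i j, ∀ m ≤ 0, (f.1 i j).coeff m = 0) :
    f ∈ lattice (shift n k) := by
  intro i j m hm
  refine hf i j m ?_
  have h1 := shift_cases k i
  have h2 := shift_cases k j
  omega

lemma exists_sub_emb_mem_lattice (f : Sl n Laurent) :
    ∃ c : PolySl n, f - (emb n c).1 ∈ lattice (shift n k) := by
  -- The least power of `u` forbidden in the entry `(i, j)`; it is `0`, `1` or `2`, so `toNat` loses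
  -- nothing.
  obtain ⟨c, hc⟩ := exists_polyPart (fun i j => (shift n k j - shift n k i + 1).toNat) 1
    (fun i => by simp) f
  refine ⟨c, fun i j m hm => ?_⟩
  change (f.1 i j - ofPoly (c.1 i j)).coeff m = 0
  have h1 := shift_cases k i
  have h2 := shift_cases k j
  rw [HahnSeries.coeff_sub]
  obtain ⟨l, rfl⟩ : ∃ l : ℕ, m = -(l : ℤ) := ⟨(-m).toNat, by omega⟩
  rw [coeff_ofPoly_neg, hc, if_pos (by omega), sub_self]

lemma Q_mk_zero_left (f : Sl n Laurent) (y : Double n) :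
    Q n (f, 0) y = (K f y.1).coeff (-1) := by
  rw [Q_apply, map_zero, map_zero, K_zero_left, K_zero_left, sub_zero, sub_zero]

lemma Q_mk_zero_right (A : Sl n (DualNumber ℂ)) (y : Double n) :
    Q n y (0, A) = -(K (part₀ n y.2) (part₁ n A) + K (part₁ n y.2) (part₀ n A)) := by
  rw [Q_apply, K_zero_right, HahnSeries.coeff_zero]
  ring

/-- A quasi-rational r-matrix related to `W_k` gives a pair. -/
lemma exists_pair (hn : n ≠ 0) (q : RMatrix n) (hq : (q.W : Set (Double n)) ⊆ orderW n k) :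
    ∃ c : Pair n k, (q.W : Set (Double n)) = order n k ×ˢ c.lagr := by
  have hsub : ∀ x ∈ graph q.p, x.1 ∈ lattice (shift n k) := fun x hx => by
    have h : x.1 ∈ order n k := hq hx
    rwa [order_eq_lattice] at h
  -- As `A_k` is isotropic and contains all first components, it is orthogonal to the graph.
  have hord : ∀ f ∈ lattice (shift n k), ((f, 0) : Double n) ∈ graph q.p := fun f hf =>
    mem_graph_of_Q hn q.skew fun y hy => by
      rw [Q_comm, Q_mk_zero_left, coeff_K_lattice hf (hsub y hy)]
  let V : Submodule ℂ (Sl n (DualNumber ℂ)) := (graph q.p).comap (LinearMap.inr ℂ _ _)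
  have hV : ∀ A, A ∈ V ↔ ((0, A) : Double n) ∈ graph q.p := fun A => Iff.rfl
  have hprod : ∀ x, x ∈ graph q.p ↔ x.1 ∈ lattice (shift n k) ∧ x.2 ∈ V := by
    intro x
    have e : x = (x.1, 0) + (0, x.2) := by simp
    constructor
    · intro hx
      refine ⟨hsub x hx, (hV _).2 ?_⟩
      have := sub_mem hx (hord _ (hsub x hx))
      rwa [show x - (x.1, 0) = (0, x.2) from Prod.ext (sub_self _) (sub_zero _)] at this
    · rintro ⟨h1, h2⟩
      rw [e]
      exact add_mem (hord _ h1) h2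
  obtain ⟨c, hc⟩ := exists_lagr_eq (k := k) hn V
    (fun A hA A' hA' => by
      have h := lie_mem_graph hn q.skew q.cybe hA hA'
      exact ((hprod _).1 h).2)
    (fun A hA A' hA' => by
      have h := Q_graph q.skew hA hA'
      change Q n (0, A) (0, A') = 0 at h
      rw [Q_mk_zero_right] at h
      exact neg_eq_zero.1 h)
    (fun A hA => mem_graph_of_Q hn q.skew fun y hy => by
      have h := hA y.2 ((hprod y).1 hy).2
      change Q n y (0, A) = 0
      rw [Q_mk_zero_right, h, neg_zero])
    -- An element `x + a ε` of `V` of this shape lifts to `i(x + a u)`, which lies in the graph and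
    -- must vanish.
    (fun x a hx ha hxa => by
      have hmem : emb n (tens 1 x + tens Polynomial.X a) ∈ graph q.p :=
        (hprod _).2 ⟨emb_fst_mem_lattice hx ha, by rw [emb_snd_tens]; exact hxa⟩
      have h0 := emb_snd_tens x a
      rw [emb_mem_graph hn hmem, map_zero] at h0
      have h1 := congrArg (part₀ n) h0
      have h2 := congrArg (part₁ n) h0
      rw [part₀_dual] at h1
      rw [part₁_dual] at h2
      exact ⟨h1.symm.trans (map_zero _), h2.symm.trans (map_zero _)⟩)
  refine ⟨c, Set.ext fun x => ?_⟩
  rw [Set.mem_prod, hc, order_eq_lattice]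
  exact hprod x

/-- A pair gives a quasi-rational r-matrix related to `W_k`. -/
lemma exists_rMatrix (hn : n ≠ 0) (c : Pair n k) :
    ∃ q : RMatrix n, (q.W : Set (Double n)) = order n k ×ˢ c.lagr := by
  let W : Submodule ℂ (Double n) := (lattice (shift n k)).prod c.lagrSubmodule
  have hW : ∀ x, x ∈ W ↔ x.1 ∈ lattice (shift n k) ∧ x.2 ∈ c.lagr := fun x => Submodule.mem_prod
  obtain ⟨p, hp, hgraph⟩ := exists_graph_eq hn W
    (fun x hx y hy => by
      obtain ⟨hx1, hx2⟩ := (hW x).1 hx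
      obtain ⟨hy1, hy2⟩ := (hW y).1 hy
      have h := c.lagr_isotropic hx2 hy2
      rw [Q_apply, coeff_K_lattice hx1 hy1]
      linear_combination -h)
    -- A polynomial first moves the series into `A_k`; one of the form `y + b u`, invisible modulo
    -- `A_k`, then corrects the dual-number component.
    (fun x => by
      obtain ⟨c₁, h₁⟩ := exists_sub_emb_mem_lattice (k := k) x.1
      obtain ⟨y, hy, b, hb, h₂⟩ := c.exists_sub_dual_mem_lagr hn (x.2 - (emb n c₁).2)
      refine ⟨c₁ + (tens 1 y + tens Polynomial.X b), (hW _).2 ⟨?_, ?_⟩⟩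
      · rw [map_add, ← sub_sub, Prod.fst_sub, Prod.fst_sub]
        exact sub_mem h₁ (emb_fst_mem_lattice hy hb)
      · rw [map_add, ← sub_sub, Prod.snd_sub, Prod.snd_sub, emb_snd_tens]
        exact h₂)
    (fun d hd => by
      obtain ⟨h1, h2⟩ := (hW _).1 hd
      obtain ⟨hc0, hc1, hc2⟩ := coef_of_emb_mem_lattice h1
      have h0 := c.eq_zero_of_mem_lagr hn h2 (by rwa [part₀_emb]) (by rwa [part₁_emb])
      have e0 : coef 0 d = 0 := by rw [← part₀_emb, h0, map_zero]
      have e1 : coef 1 d = 0 := by rw [← part₁_emb, h0, map_zero]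
      apply Subtype.ext
      ext i j m
      match m with
      | 0 => rw [← coef_apply, e0]; rfl
      | 1 => rw [← coef_apply, e1]; rfl
      | m + 2 => exact hc2 i j _ (by omega))
    (fun f hf => (hW _).2 ⟨mem_lattice_of_small f hf, c.lagrSubmodule.zero_mem⟩)
  refine ⟨⟨p, hp, cybe_of_lie_mem hn hp fun x hx y hy => ?_⟩, ?_⟩
  · rw [hgraph, hW] at *
    exact ⟨lie_mem_lattice hx.1 hy.1, c.lie_mem_lagr hx.2 hy.2⟩
  · change (graph p : Set (Double n)) = _
    rw [hgraph, order_eq_lattice]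
    rfl

lemma rMatrix_ext (hn : n ≠ 0) {q q' : RMatrix n} (h : (q.W : Set (Double n)) = q'.W) :
    q = q' :=
  RMatrix.ext (eq_of_contract_eq hn fun _ hw =>
    contract_eq_of_graph_eq hn (SetLike.coe_injective h) hw)

end Order

end QuasiRational

end
-- The bijection
open QuasiRational in
theorem theorem5 (n k : ℕ) (hn : 2 ≤ n) (hk : k ≤ n) :
    ∃ Φ : {q : RMatrix n // (q.W : Set (Double n)) ⊆ orderW n k} ≃ Pair n k,
      ∀ q, (q.1.W : Set (Double n)) = (order n k) ×ˢ (Φ q).lagr := by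
  have hn0 : n ≠ 0 := by omega
  choose Φ hΦ using fun q : {q : RMatrix n // (q.W : Set (Double n)) ⊆ orderW n k} =>
    exists_pair hn0 q.1 q.2
  refine ⟨Equiv.ofBijective Φ ⟨fun q q' h => ?_, fun c => ?_⟩, hΦ⟩
  · refine Subtype.ext (rMatrix_ext hn0 ?_)
    rw [hΦ q, hΦ q', h]
  · obtain ⟨q, hq⟩ := exists_rMatrix hn0 c
    have hq' : (q.W : Set (Double n)) ⊆ orderW n k := fun x hx => by
      rw [hq] at hx
      exact hx.1
    refine ⟨⟨q, hq'⟩, Pair.lagr_injective hn0 (Set.ext fun A => ?_)⟩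
    have h := (hΦ ⟨q, hq'⟩).symm.trans hq
    -- As `0 ∈ A_k`, slicing the two product sets over `0` recovers their second factors.
    have h0 : (0 : Sl n Laurent) ∈ order n k := by
      rw [order_eq_lattice]
      exact zero_mem _
    have hA := Set.ext_iff.1 h (0, A)
    simpa only [Set.mem_prod, h0, true_and] using hA
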